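/- Let $a<b$ be real numbers and let $Q$ be continuous on $\mathbb R\setminus(a,b)$ with $Q(x)\ge\tilde Q>0$ there and $\lim_{|x|\to\infty}Q(x)=\tilde Q$. **Function spaces.** Let $H^{1/2}(\mathbb R)$ be the space of $u\in L^2(\mathbb R)$ with $\|u\|_{1/2}^2=\int_{\mathbb R}|u|^2dx+\iint_{\mathbb R^2}\frac{|u(x)-u(y)|^2}{|x-y|^2}\,dy\,dx<\infty$. Let $H$ be the space of measurable $u:\mathbb R\to\mathbb R$ (modulo equality almost everywhere) with $$\|u\|_H^2=\frac1{2\pi}\iint_{\mathbb R^2\setminus(a,b)^2}\frac{|u(x)-u(y)|^2}{|x-y|^2}\,dy\,dx+\int_{\mathbb R\setminus(a,b)}|u|^2dx<\infty .$$ **Nonlinearity.** Let $f\in C^1(\mathbb R,\mathbb R)$ be odd, put $F(s)=\int_0^sf(t)\,dt$, and assume: 1. there is $C$ with $|f(s)|\le Ce^{\pi s^2}$ for all $s\in\mathbb R$; 2. there is $\theta>2$ with $0<\theta F(s)\le sf(s)$ for all $s\ne0$; 3. there is $q>1$ with $\limsup_{s\to0}|f(s)|/|s|^q<\infty$; 4.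 $s\mapsto f(s)/s$ is nondecreasing on $(0,\infty)$; 5. there are $p>q+1$ and $C_p>0$ with $f(s)\ge C_ps^{p-1}$ for all $s\ge0$ and $$C_p>\left(\frac{(p-2)\,2\xi\theta}{(\theta-2)p}\right)^{\frac{p-2}2}S_p^p,\qquad S_p=\inf_{u\in H^{1/2}(\mathbb R)\setminus\{0\}}\frac{\|u\|_{1/2}}{\left(\int_{\mathbb R}\tilde Q|u|^pdx\right)^{1/p}},$$ where $\xi>0$ is a constant for which there is a linear extension operator $E:H\to H^{1/2}(\mathbb R)$ with $Eu=u$ a.e. on $\mathbb R\setminus(a,b)$ and $\|Eu\|_{1/2}\le\xi\|u\|_H$ for all $u\in H$. **Ground state.** Let $f_+(s)=f(s)$ for $s>0$, $f_+(s)=0$ for $s\le0$, and $F_+(s)=\int_0^sf_+(t)\,dt$. Consider on $H$ the functional $$I(u)=\frac12\|u\|_H^2-\int_{\mathbb R\setminus(a,b)}Q(x)F_+(u)\,dx,\qquad c_1=\inf_{w\in H\setminus\{0\}}\ \sup_{\sigma\ge0}I(\sigma w).$$ Let $u\in H$ be a ground state of the problem $$(-\Delta)^{1/2}u+u=Q(x)f_+(u)\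 \text{ in }\mathbb R\setminus(a,b),\qquad \mathcal N_{1/2}u(x)=\frac1\pi\int_{\mathbb R\setminus(a,b)}\frac{u(x)-u(y)}{|x-y|^2}\,dy=0\ \text{ in }(a,b),$$ that is, $I(u)=c_1$ and $u$ is a weak solution: for all $v\in H$, $$\frac1{2\pi}\iint_{\mathbb R^2\setminus(a,b)^2}\frac{[u(x)-u(y)][v(x)-v(y)]}{|x-y|^2}\,dy\,dx+\int_{\mathbb R\setminus(a,b)}uv\,dx=\int_{\mathbb R\setminus(a,b)}Q(x)f_+(u)v\,dx .$$ Then there is a constant $C>0$ such that $$0\le u(x)\le\frac{C}{|x|^2}\qquad\text{for almost every }x\in\mathbb R\setminus\{0\}.$$ -/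

import Mathlib

open MeasureTheory Set Filter Topology Asymptotics

noncomputable section

namespace ExteriorNeumann

/-- The bilinear difference quotient `(u(x)-u(y)) (v(x)-v(y)) / |x-y|^2`
(its value on the null set `x = y` is irrelevant). -/
def diffQuot (u v : ℝ → ℝ) (z : ℝ × ℝ) : ℝ :=
  (u z.1 - u z.2) * (v z.1 - v z.2) / |z.1 - z.2| ^ 2

/-- `u` belongs to the fractional Sobolev space `H^{1/2}(ℝ)`. Elements are represented by
Lebesgue measurable functions. -/
def MemHHalf (u : ℝ → ℝ) : Prop :=
  AEMeasurable u volume ∧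
  Integrable (diffQuot u u) (volume : Measure (ℝ × ℝ)) ∧
  Integrable (fun x => u x ^ 2) (volume : Measure ℝ)

/-- The norm of `H^{1/2}(ℝ)`. -/
def normHHalf (u : ℝ → ℝ) : ℝ :=
  Real.sqrt ((∫ x, u x ^ 2) + ∫ z : ℝ × ℝ, diffQuot u u z)

/-- The exterior domain `ℝ \ (a,b)`. -/
def extDom (a b : ℝ) : Set ℝ := (Ioo a b)ᶜ

/-- The set `ℝ² \ (a,b)²`. -/
def extSq (a b : ℝ) : Set (ℝ × ℝ) := (Ioo a b ×ˢ Ioo a b)ᶜ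

/-- `u : ℝ → ℝ` belongs to the space `H^{1/2}_{ℝ \ (a,b)}` of the Neumann problem: it is Lebesgue
measurable with finite Gagliardo energy on `ℝ² \ (a,b)²` and square integrable on `ℝ \ (a,b)`. -/
def MemH (a b : ℝ) (u : ℝ → ℝ) : Prop :=
  AEMeasurable u volume ∧
  IntegrableOn (diffQuot u u) (extSq a b) ∧
  IntegrableOn (fun x => u x ^ 2) (extDom a b)

/-- The norm of `H^{1/2}_{ℝ \ (a,b)}`. -/
def normH (a b : ℝ) (u : ℝ → ℝ) : ℝ :=
  Real.sqrt (1 / (2 * Real.pi) * (∫ z in extSq a b, diffQuot u u z) + ∫ x in extDom a b, u x ^ 2)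

/-- `ξ` is a bound for a linear extension operator from `H^{1/2}_{ℝ \ (a,b)}` to `H^{1/2}(ℝ)`.
(`E` is written on all functions; only its values on the first space matter.) -/
def IsExtensionBound (a b ξ : ℝ) : Prop :=
  ∃ E : (ℝ → ℝ) →ₗ[ℝ] (ℝ → ℝ), ∀ u, MemH a b u →
    MemHHalf (E u) ∧ (∀ᵐ x, x ∈ extDom a b → E u x = u x) ∧ normHHalf (E u) ≤ ξ * normH a b u

/-- The best constant `S_p = inf ‖u‖_{1/2} / (∫ Q̃ |u|^p)^{1/p}` over nonzero `u ∈ H^{1/2}(ℝ)`. -/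
def sobolevConst (Qt p : ℝ) : ℝ :=
  sInf {r : ℝ | ∃ u : ℝ → ℝ, MemHHalf u ∧ ¬ (u =ᵐ[volume] 0) ∧
    r = normHHalf u / (∫ x, Qt * |u x| ^ p) ^ (1 / p)}

/-- The primitive `F(s) = ∫_0^s f`. -/
def primitive (f : ℝ → ℝ) (s : ℝ) : ℝ := ∫ t in (0 : ℝ)..s, f t

/-- The nonlinearity `f` replaced by zero on `(-∞, 0]`. -/
def truncation (f : ℝ → ℝ) (s : ℝ) : ℝ := if s ≤ 0 then 0 else f s

/-- The energy functional of the Neumann problem with nonlinearity `g`. -/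
def energy (a b : ℝ) (Q g : ℝ → ℝ) (u : ℝ → ℝ) : ℝ :=
  1 / (4 * Real.pi) * (∫ z in extSq a b, diffQuot u u z)
    + 1 / 2 * (∫ x in extDom a b, u x ^ 2)
    - ∫ x in extDom a b, Q x * primitive g (u x)

/-- The minimax level `c₁ = inf_{u ≠ 0} sup_{σ ≥ 0} I(σ u)`, with values in the extended reals. -/
def level (a b : ℝ) (Q g : ℝ → ℝ) : EReal :=
  ⨅ w ∈ {w : ℝ → ℝ | MemH a b w ∧ ¬ (w =ᵐ[volume] 0)},
    ⨆ σ ∈ Ici (0 : ℝ), ((energy a b Q g (fun x => σ * w x) : ℝ) : EReal)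

/-- `u` is a weak solution of `(-Δ)^{1/2} u + u = Q g(u)` in `ℝ \ (a,b)` with nonlocal Neumann
condition in `(a,b)`, that is, a critical point of the energy functional. -/
def IsWeakSolution (a b : ℝ) (Q g : ℝ → ℝ) (u : ℝ → ℝ) : Prop :=
  MemH a b u ∧ ∀ v : ℝ → ℝ, MemH a b v →
    1 / (2 * Real.pi) * (∫ z in extSq a b, diffQuot u v z) + (∫ x in extDom a b, u x * v x)
      = ∫ x in extDom a b, Q x * g (u x) * v x

/-- A ground state: a weak solution whose energy is the minimax level. -/
def IsGroundState (a b : ℝ) (Q g : ℝ → ℝ) (u : ℝ → ℝ) : Prop :=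
  IsWeakSolution a b Q g u ∧ ((energy a b Q g u : ℝ) : EReal) = level a b Q g

end ExteriorNeumann

end

namespace ExteriorNeumann

/-! The proof tests the weak equation with truncations of `u` and compares `u` with the barrier `w =
1 / (l² + x²)`. The test function `min u 0` gives `u ≥ 0`.

The decay of `w` is the natural rate for `(-Δ)^{1/2}`, and `(-Δ)^{1/2} w ≥ -(4 / l) w` on the line
(`le_integral_diffQuot_barrier`). Since `q > 1`, the term `Q f₊(u)` is at most `u / 4` wherever `u`
is small. For `l = 16`, testing with `(u - M w)⁺` then forces `u ≤ M w`, as long as `M w ≥ u` on a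
large interval containing `(a, b)`, and `M w ≤ M / x²`. This needs two inputs: `u` is bounded, and
`u` tends to `0` at infinity.

Both come from Stampacchia iteration on the measures of superlevel sets. The engine is
`sq_mul_measure_le_energy`: if `v ≥ d` on `A` and `v` vanishes off `B`, then `d² |A| ≤ 4 |B|` times
the energy of `v`. Cutting the range of `u` into thin slices, whose energies add up to at most the
total, this inequality also yields Gaussian decay of the superlevel sets. Hence `exp (c u²)` is
integrable over a high superlevel set for every `c > 0`, which controls a nonlinearity of growth
`exp (π s²)`. -/

variable {a b : ℝ} {u v : ℝ → ℝ}

/-! ### The energy space and its bilinear form -/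

lemma measurableSet_extDom : MeasurableSet (extDom a b) := measurableSet_Ioo.compl

lemma measurableSet_extSq : MeasurableSet (extSq a b) :=
  (measurableSet_Ioo.prod measurableSet_Ioo).compl

lemma diffQuot_self_nonneg (u : ℝ → ℝ) (z : ℝ × ℝ) : 0 ≤ diffQuot u u z :=
  div_nonneg (mul_self_nonneg _) (by positivity)

lemma aemeasurable_diffQuot (hu : AEMeasurable u volume) (hv : AEMeasurable v volume) :
    AEMeasurable (diffQuot u v) (volume : Measure (ℝ × ℝ)) := by
  have h1 : ∀ {w : ℝ → ℝ}, AEMeasurable w volume →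
      AEMeasurable (fun z : ℝ × ℝ => w z.1) volume := fun h =>
    h.comp_quasiMeasurePreserving Measure.quasiMeasurePreserving_fst
  have h2 : ∀ {w : ℝ → ℝ}, AEMeasurable w volume →
      AEMeasurable (fun z : ℝ × ℝ => w z.2) volume := fun h =>
    h.comp_quasiMeasurePreserving Measure.quasiMeasurePreserving_snd
  unfold diffQuot
  refine (((h1 hu).sub (h2 hu)).mul ((h1 hv).sub (h2 hv))).div (Measurable.aemeasurable ?_)
  fun_prop

lemma abs_diffQuot_le (u v : ℝ → ℝ) (z : ℝ × ℝ) :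
    |diffQuot u v z| ≤ diffQuot u u z + diffQuot v v z := by
  unfold diffQuot
  rw [abs_div, abs_of_nonneg (by positivity : (0 : ℝ) ≤ |z.1 - z.2| ^ 2), ← add_div]
  refine div_le_div_of_nonneg_right ?_ (by positivity)
  rw [abs_le]
  constructor <;>
    nlinarith [sq_nonneg ((u z.1 - u z.2) + (v z.1 - v z.2)),
      sq_nonneg ((u z.1 - u z.2) - (v z.1 - v z.2)), sq_nonneg (u z.1 - u z.2),
      sq_nonneg (v z.1 - v z.2)]

lemma MemH.integrableOn_diffQuot (hu : MemH a b u) (hv : MemH a b v) :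
    IntegrableOn (diffQuot u v) (extSq a b) :=
  (hu.2.1.add hv.2.1).mono' (aemeasurable_diffQuot hu.1 hv.1).aestronglyMeasurable.restrict
    (Eventually.of_forall fun z => abs_diffQuot_le u v z)

lemma MemH.integrableOn_mul (hu : MemH a b u) (hv : MemH a b v) :
    IntegrableOn (fun x => u x * v x) (extDom a b) := by
  refine (hu.2.2.add hv.2.2).mono' (hu.1.mul hv.1).aestronglyMeasurable.restrict
    (Eventually.of_forall fun x => ?_)
  rw [Real.norm_eq_abs, abs_le]
  constructor <;> simp only [Pi.add_apply] <;>
    nlinarith [sq_nonneg (u x + v x), sq_nonneg (u x - v x), sq_nonneg (u x), sq_nonneg (v x)]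

lemma diffQuot_sub_left (u₁ u₂ v : ℝ → ℝ) (z : ℝ × ℝ) :
    diffQuot (fun x => u₁ x - u₂ x) v z = diffQuot u₁ v z - diffQuot u₂ v z := by
  unfold diffQuot; ring

lemma diffQuot_const_mul_left (c : ℝ) (u v : ℝ → ℝ) (z : ℝ × ℝ) :
    diffQuot (fun x => c * u x) v z = c * diffQuot u v z := by
  unfold diffQuot; ring

lemma MemH.sub (hu : MemH a b u) (hv : MemH a b v) : MemH a b (fun x => u x - v x) := by
  have hm : AEMeasurable (fun x => u x - v x) volume := hu.1.sub hv.1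
  refine ⟨hm, ?_, ?_⟩
  · refine ((hu.2.1.add hv.2.1).const_mul 2).mono'
      (aemeasurable_diffQuot hm hm).aestronglyMeasurable.restrict (Eventually.of_forall fun z => ?_)
    rw [Real.norm_eq_abs, abs_of_nonneg (diffQuot_self_nonneg _ z)]
    simp only [Pi.add_apply, diffQuot]
    rw [← add_div, ← mul_div_assoc]
    refine div_le_div_of_nonneg_right ?_ (by positivity)
    nlinarith [sq_nonneg ((u z.1 - u z.2) + (v z.1 - v z.2))]
  · refine ((hu.2.2.add hv.2.2).const_mul 2).mono'
      (hm.pow_const 2).aestronglyMeasurable.restrict (Eventually.of_forall fun z => ?_)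
    rw [Real.norm_eq_abs, abs_of_nonneg (by positivity)]
    simp only [Pi.add_apply]
    nlinarith [sq_nonneg (u z + v z)]

lemma MemH.const_mul (c : ℝ) (hu : MemH a b u) : MemH a b (fun x => c * u x) := by
  refine ⟨hu.1.const_mul c, ?_, ?_⟩
  · have := hu.2.1.const_mul (c ^ 2)
    refine this.congr (Eventually.of_forall fun z => ?_)
    simp only [diffQuot]; ring
  · have := hu.2.2.const_mul (c ^ 2)
    refine this.congr (Eventually.of_forall fun z => ?_)
    simp only []; ring

/-! ### Lipschitz truncations -/

lemma diffQuot_comp_le {Φ : ℝ → ℝ} (hΦ : LipschitzWith 1 Φ) (u : ℝ → ℝ) (z : ℝ × ℝ) :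
    diffQuot (fun x => Φ (u x)) (fun x => Φ (u x)) z ≤ diffQuot u u z := by
  unfold diffQuot
  refine div_le_div_of_nonneg_right ?_ (by positivity)
  have := hΦ.dist_le_mul (u z.1) (u z.2)
  simp only [Real.dist_eq, NNReal.coe_one, one_mul] at this
  rw [← pow_two, ← pow_two]
  exact sq_le_sq.2 this

lemma MemH.comp {Φ : ℝ → ℝ} (hΦ : LipschitzWith 1 Φ) (h0 : Φ 0 = 0) (hu : MemH a b u) :
    MemH a b (fun x => Φ (u x)) := by
  have hm : AEMeasurable (fun x => Φ (u x)) volume :=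
    hΦ.continuous.measurable.comp_aemeasurable hu.1
  refine ⟨hm, ?_, ?_⟩
  · refine hu.2.1.mono'
      (aemeasurable_diffQuot hm hm).aestronglyMeasurable.restrict (Eventually.of_forall fun z => ?_)
    rw [Real.norm_eq_abs, abs_of_nonneg (diffQuot_self_nonneg _ z)]
    exact diffQuot_comp_le hΦ u z
  · refine hu.2.2.mono' (hm.pow_const 2).aestronglyMeasurable.restrict
      (Eventually.of_forall fun x => ?_)
    rw [Real.norm_eq_abs, abs_of_nonneg (by positivity)]
    have := hΦ.dist_le_mul (u x) 0
    simp only [Real.dist_eq, NNReal.coe_one, one_mul, h0, sub_zero] at this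
    exact sq_le_sq.2 this

/-- Composition with a nondecreasing `1`-Lipschitz function can be tested against. -/
lemma diffQuot_comp_self_le {Φ : ℝ → ℝ} (hΦ : LipschitzWith 1 Φ) (hm : Monotone Φ) (u : ℝ → ℝ)
    (z : ℝ × ℝ) : diffQuot (fun x => Φ (u x)) (fun x => Φ (u x)) z
      ≤ diffQuot u (fun x => Φ (u x)) z := by
  unfold diffQuot
  refine div_le_div_of_nonneg_right ?_ (by positivity)
  have := hΦ.dist_le_mul (u z.1) (u z.2)
  simp only [Real.dist_eq, NNReal.coe_one, one_mul] at this
  rcases le_total (u z.1) (u z.2) with h | h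
  · have h' := hm h
    rw [abs_of_nonpos (by linarith), abs_of_nonpos (by linarith)] at this
    nlinarith
  · have h' := hm h
    rw [abs_of_nonneg (by linarith), abs_of_nonneg (by linarith)] at this
    nlinarith

lemma lipschitzWith_posPart_sub (k : ℝ) : LipschitzWith 1 (fun s : ℝ => max (s - k) 0) := by
  refine LipschitzWith.of_dist_le_mul fun s t => ?_
  simp only [Real.dist_eq, NNReal.coe_one, one_mul]
  have := abs_max_sub_max_le_max (s - k) 0 (t - k) 0
  simpa using this

lemma monotone_posPart_sub (k : ℝ) : Monotone (fun s : ℝ => max (s - k) 0) :=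
  fun _ _ h => max_le_max (by linarith) le_rfl

lemma MemH.posPart_sub (hu : MemH a b u) {k : ℝ} (hk : 0 ≤ k) :
    MemH a b (fun x => max (u x - k) 0) :=
  hu.comp (lipschitzWith_posPart_sub k) (by simpa using hk)

/-- A function vanishing outside `(a,b)` with vanishing energy is zero. -/
lemma ae_eq_zero_of_energy_nonpos (hv : MemH a b v)
    (h0 : ∀ᵐ x, x ∈ extDom a b → v x = 0) (hE : ∫ z in extSq a b, diffQuot v v z ≤ 0) :
    v =ᵐ[volume] 0 := by
  have hE0 : ∫ z in extSq a b, diffQuot v v z = 0 :=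
    le_antisymm hE (integral_nonneg fun z => diffQuot_self_nonneg v z)
  rw [integral_eq_zero_iff_of_nonneg (fun z => diffQuot_self_nonneg v z) hv.2.1] at hE0
  have h1 := (ae_restrict_iff' measurableSet_extSq).1 hE0
  have h2 : ∀ᵐ x : ℝ, ∀ᵐ y : ℝ, (x, y) ∈ extSq a b → diffQuot v v (x, y) = 0 :=
    Measure.ae_ae_of_ae_prod h1
  filter_upwards [h2, h0] with x hx hx0
  by_cases hxe : x ∈ extDom a b
  · exact hx0 hxe
  -- A point `x` of `(a, b)` still interacts with almost every `y` just to the right of `b`, where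
  -- `v y = 0`; the vanishing quotient `v(x)² / |x - y|²` gives `v x = 0`.
  have hpos : volume (Ioo b (b + 1)) ≠ 0 := by simp
  obtain ⟨y, hy, hy1, hy2⟩ : ∃ y ∈ Ioo b (b + 1),
      ((x, y) ∈ extSq a b → diffQuot v v (x, y) = 0) ∧ (y ∈ extDom a b → v y = 0) := by
    by_contra hcon
    push Not at hcon
    refine hpos (measure_mono_null (fun y hy => ?_) (hx.and h0))
    simp only [mem_compl_iff, mem_ofPred_eq]
    exact fun h => (hcon y hy h.1).elim (fun h3 h4 => h4 (h.2 h3))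
  have hxm : x ∈ Ioo a b := by simpa [extDom] using hxe
  have hyn : y ∉ Ioo a b := fun h => absurd h.2 (not_lt.2 hy.1.le)
  have e1 := hy1 (fun h => hyn h.2)
  have e2 := hy2 hyn
  have hne : |x - y| ^ 2 ≠ 0 := by
    have : x - y ≠ 0 := by have := hxm.2; have := hy.1; intro h; linarith
    positivity
  simp only [diffQuot, e2, sub_zero, div_eq_zero_iff, hne, or_false] at e1
  simpa using e1

/-! ### Testing with truncations: comparison and nonnegativity -/

/-- Testing the equation with the positive part of `u - ψ - k`. -/
lemma IsWeakSolution.comparison {Q g ψ : ℝ → ℝ} (hu : IsWeakSolution a b Q g u)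
    (hψ : MemH a b ψ) {k : ℝ} (hk : 0 ≤ k) :
    1 / (2 * Real.pi) * (∫ z in extSq a b, diffQuot (fun x => max (u x - ψ x - k) 0)
        (fun x => max (u x - ψ x - k) 0) z)
      + 1 / (2 * Real.pi) * (∫ z in extSq a b, diffQuot ψ (fun x => max (u x - ψ x - k) 0) z)
      + (∫ x in extDom a b, u x * max (u x - ψ x - k) 0)
      ≤ ∫ x in extDom a b, Q x * g (u x) * max (u x - ψ x - k) 0 := by
  have hd := hu.1.sub hψ
  have hφ := hd.posPart_sub hk
  rw [← hu.2 _ hφ, ← mul_add, ← integral_add (hφ.integrableOn_diffQuot hφ)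
    (hψ.integrableOn_diffQuot hφ)]
  refine add_le_add_left (mul_le_mul_of_nonneg_left (integral_mono ((hφ.integrableOn_diffQuot hφ).add
    (hψ.integrableOn_diffQuot hφ)) (hu.1.integrableOn_diffQuot hφ) fun z => ?_) (by positivity)) _
  have h1 := diffQuot_comp_self_le (lipschitzWith_posPart_sub k) (monotone_posPart_sub k)
    (fun x => u x - ψ x) z
  rw [diffQuot_sub_left] at h1
  rw [Pi.add_apply]
  linarith

/-- Weak solutions with nonlinearity vanishing on the negative half-line are nonnegative. -/
lemma IsWeakSolution.ae_nonneg {Q g : ℝ → ℝ} (hg : ∀ s ≤ 0, g s = 0)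
    (hu : IsWeakSolution a b Q g u) : ∀ᵐ x, 0 ≤ u x := by
  have hL : LipschitzWith 1 (fun s : ℝ => min s 0) := by
    refine LipschitzWith.of_dist_le_mul fun s t => ?_
    simpa [Real.dist_eq] using abs_min_sub_min_le_max s 0 t 0
  have hm : Monotone (fun s : ℝ => min s 0) := fun _ _ h => min_le_min h le_rfl
  have hv : MemH a b (fun x => min (u x) 0) := hu.1.comp hL (by simp)
  have key := hu.2 _ hv
  have hR : (∫ x in extDom a b, Q x * g (u x) * min (u x) 0) = 0 := by
    refine integral_eq_zero_of_ae (Eventually.of_forall fun x => ?_)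
    rcases le_total (u x) 0 with h | h
    · simp [hg _ h]
    · simp [min_eq_right h]
  have hM : (∫ x in extDom a b, u x * min (u x) 0) = ∫ x in extDom a b, (min (u x) 0) ^ 2 := by
    refine integral_congr_ae (Eventually.of_forall fun x => ?_)
    rcases le_total (u x) 0 with h | h
    · simp [min_eq_left h, pow_two]
    · simp [min_eq_right h]
  have hE : (∫ z in extSq a b, diffQuot (fun x => min (u x) 0) (fun x => min (u x) 0) z)
      ≤ ∫ z in extSq a b, diffQuot u (fun x => min (u x) 0) z :=
    integral_mono hv.2.1 (hu.1.integrableOn_diffQuot hv)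
      fun z => diffQuot_comp_self_le hL hm u z
  have hE0 : 0 ≤ ∫ z in extSq a b, diffQuot (fun x => min (u x) 0) (fun x => min (u x) 0) z :=
    integral_nonneg fun z => diffQuot_self_nonneg _ z
  have hM0 : 0 ≤ ∫ x in extDom a b, (min (u x) 0) ^ 2 := integral_nonneg fun z => sq_nonneg _
  rw [hR, hM] at key
  have hpi : 0 < 1 / (2 * Real.pi) := by positivity
  have hI : (∫ z in extSq a b, diffQuot u (fun x => min (u x) 0) z) ≤ 0 := by
    by_contra hcon
    have := mul_pos hpi (not_le.1 hcon)
    linarith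
  -- The right side vanishes because `g` and `min u 0` have disjoint supports, so both nonnegative
  -- terms on the left are zero. The mass term only sees `extDom`; the energy term carries the
  -- conclusion into `(a, b)`.
  have hM1 : ∫ x in extDom a b, (min (u x) 0) ^ 2 = 0 := by
    have := mul_nonneg hpi.le (hE0.trans hE)
    linarith
  rw [integral_eq_zero_iff_of_nonneg (fun z => sq_nonneg _) hv.2.2] at hM1
  have h0 : ∀ᵐ x, x ∈ extDom a b → min (u x) 0 = 0 := by
    filter_upwards [(ae_restrict_iff' measurableSet_extDom).1 hM1] with x hx hxe
    simpa using hx hxe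
  filter_upwards [ae_eq_zero_of_energy_nonpos hv h0 (hE.trans hI)] with x hx
  simpa using hx

/-! ### Isoperimetric inequality and superlevel sets -/

/-- The interval `J` of length `2m` that starts at `x` and points away from `(a, b)` lies in
`extDom`. Removing `B` leaves measure at least `m`, where the kernel is at least `1 / (2m)²`. -/
lemma inv_le_lintegral_kernel {x m : ℝ} (hx : x ∈ extDom a b) (hm : 0 < m) {B : Set ℝ}
    (hB : MeasurableSet B) (hBm : volume B ≤ ENNReal.ofReal m) :
    ENNReal.ofReal (1 / (4 * m)) ≤ ∫⁻ y in extDom a b \ B, ENNReal.ofReal (1 / |x - y| ^ 2) := by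
  obtain ⟨J, hJm, hJv, hJe, hJd⟩ : ∃ J : Set ℝ, MeasurableSet J ∧ volume J = ENNReal.ofReal (2 * m)
      ∧ J ⊆ extDom a b ∧ ∀ y ∈ J, |x - y| ≤ 2 * m ∧ x - y ≠ 0 := by
    have hx' : x ≤ a ∨ b ≤ x := by
      by_contra hcon
      push Not at hcon
      exact hx hcon
    rcases hx' with h | h
    · refine ⟨Ioo (x - 2 * m) x, measurableSet_Ioo, by simp, fun y hy hy' => ?_, fun y hy => ?_⟩
      · exact absurd hy'.1 (not_lt.2 (hy.2.le.trans h))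
      · rw [abs_le]
        exact ⟨⟨by linarith [hy.2], by linarith [hy.1]⟩, by have := hy.2; intro h; linarith⟩
    · refine ⟨Ioo x (x + 2 * m), measurableSet_Ioo, by simp, fun y hy hy' => ?_, fun y hy => ?_⟩
      · exact absurd hy'.2 (not_lt.2 (h.trans hy.1.le))
      · rw [abs_le]
        exact ⟨⟨by linarith [hy.2], by linarith [hy.1]⟩, by have := hy.1; intro h; linarith⟩
  have hvol : ENNReal.ofReal m ≤ volume (J \ B) := by
    refine le_trans ?_ le_measure_sdiff
    rw [hJv]
    refine le_trans ?_ (tsub_le_tsub_left hBm _)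
    rw [← ENNReal.ofReal_sub _ hm.le]
    exact ENNReal.ofReal_le_ofReal (by linarith)
  calc ENNReal.ofReal (1 / (4 * m))
      = ENNReal.ofReal (1 / (2 * m) ^ 2) * ENNReal.ofReal m := by
        rw [← ENNReal.ofReal_mul (by positivity)]
        congr 1
        field_simp
        norm_num
    _ ≤ ENNReal.ofReal (1 / (2 * m) ^ 2) * volume (J \ B) := by gcongr
    _ = ∫⁻ _ in J \ B, ENNReal.ofReal (1 / (2 * m) ^ 2) := by rw [setLIntegral_const]
    _ ≤ ∫⁻ y in J \ B, ENNReal.ofReal (1 / |x - y| ^ 2) := by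
        refine setLIntegral_mono' (hJm.diff hB) fun y hy => ENNReal.ofReal_le_ofReal ?_
        obtain ⟨h1, h2⟩ := hJd y hy.1
        gcongr
    _ ≤ _ := lintegral_mono_set (sdiff_subset_sdiff_left hJe)

/-- An isoperimetric inequality for the Gagliardo energy on the exterior domain. -/
lemma sq_mul_measure_le_energy (hv : MemH a b v) {A B : Set ℝ} (hA : MeasurableSet A)
    (hB : MeasurableSet B) (hAB : A ⊆ B) (hAe : A ⊆ extDom a b) (hBf : volume B ≠ ⊤) {d : ℝ}
    (hd : 0 ≤ d) (hvA : ∀ x ∈ A, d ≤ v x) (hvB : ∀ x ∈ extDom a b, x ∉ B → v x = 0) :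
    d ^ 2 * volume.real A ≤ 4 * volume.real B * ∫ z in extSq a b, diffQuot v v z := by
  rcases (measureReal_nonneg (μ := volume) (s := B)).eq_or_lt with hB0 | hB0
  · have : volume.real A ≤ volume.real B := measureReal_mono hAB hBf
    have hA0 : volume.real A = 0 := le_antisymm (this.trans hB0.symm.le) measureReal_nonneg
    rw [hA0, ← hB0]; simp
  set m := volume.real B with hm
  set T := extDom a b \ B with hT
  have hTm : MeasurableSet T := measurableSet_extDom.diff hB
  have hBm : volume B ≤ ENNReal.ofReal m := by
    rw [hm, measureReal_def, ENNReal.ofReal_toReal hBf]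
  have hAf : volume A ≠ ⊤ := ne_top_of_le_ne_top hBf (measure_mono hAB)
  -- Only the interaction between `A` and `extDom \ B` is kept: there the jump of `v` is at least
  -- `d`, and the kernel bound applies for each `x` in `A`.
  have hsub : A ×ˢ T ⊆ extSq a b := fun z hz h => hAe hz.1 h.1
  have key : ENNReal.ofReal (d ^ 2 * (1 / (4 * m)) * volume.real A)
      ≤ ENNReal.ofReal (∫ z in extSq a b, diffQuot v v z) := by
    rw [ofReal_integral_eq_lintegral_ofReal hv.2.1
      (Eventually.of_forall fun z => diffQuot_self_nonneg v z)]
    calc ENNReal.ofReal (d ^ 2 * (1 / (4 * m)) * volume.real A)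
        = ENNReal.ofReal (d ^ 2) * ENNReal.ofReal (1 / (4 * m)) * volume A := by
          rw [ENNReal.ofReal_mul (by positivity), ENNReal.ofReal_mul (by positivity),
            measureReal_def, ENNReal.ofReal_toReal hAf]
      _ = ∫⁻ _ in A, ENNReal.ofReal (d ^ 2) * ENNReal.ofReal (1 / (4 * m)) := by
          rw [setLIntegral_const]
      _ ≤ ∫⁻ x in A, ENNReal.ofReal (d ^ 2) * ∫⁻ y in T, ENNReal.ofReal (1 / |x - y| ^ 2) := by
          refine setLIntegral_mono' hA fun x hx => ?_
          gcongr
          exact inv_le_lintegral_kernel (hAe hx) hB0 hB hBm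
      _ = ∫⁻ x in A, ∫⁻ y in T, ENNReal.ofReal (d ^ 2) * ENNReal.ofReal (1 / |x - y| ^ 2) := by
          refine lintegral_congr fun x => ?_
          rw [lintegral_const_mul _ (by fun_prop)]
      _ = ∫⁻ z in A ×ˢ T, ENNReal.ofReal (d ^ 2) * ENNReal.ofReal (1 / |z.1 - z.2| ^ 2) := by
          rw [Measure.volume_eq_prod, ← Measure.prod_restrict, lintegral_prod _ (by fun_prop)]
      _ ≤ ∫⁻ z in A ×ˢ T, ENNReal.ofReal (diffQuot v v z) := by
          refine setLIntegral_mono' (hA.prod hTm) fun z hz => ?_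
          rw [← ENNReal.ofReal_mul (by positivity)]
          refine ENNReal.ofReal_le_ofReal ?_
          rw [diffQuot, hvB z.2 hz.2.1 hz.2.2, sub_zero, mul_one_div]
          refine div_le_div_of_nonneg_right ?_ (by positivity)
          have := hvA z.1 hz.1
          nlinarith
      _ ≤ _ := lintegral_mono_set hsub
  have h2 := (ENNReal.ofReal_le_ofReal_iff
    (integral_nonneg fun z => diffQuot_self_nonneg v z)).1 key
  have h3 := mul_le_mul_of_nonneg_left h2 (by positivity : (0 : ℝ) ≤ 4 * m)
  calc d ^ 2 * volume.real A = 4 * m * (d ^ 2 * (1 / (4 * m)) * volume.real A) := by field_simp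
    _ ≤ _ := h3

/-- The superlevel sets of `u` in the exterior domain. -/
def superlevel (a b : ℝ) (u : ℝ → ℝ) (k : ℝ) : Set ℝ := extDom a b ∩ {x | k < u x}

lemma measurableSet_superlevel (hu : Measurable u) (k : ℝ) :
    MeasurableSet (superlevel a b u k) :=
  measurableSet_extDom.inter (measurableSet_lt measurable_const hu)

lemma superlevel_anti {k h : ℝ} (hkh : k ≤ h) : superlevel a b u h ⊆ superlevel a b u k :=
  fun _ hx => ⟨hx.1, lt_of_le_of_lt hkh hx.2⟩

lemma measure_le_integral_sq_div (hu : MemH a b u) {S : Set ℝ}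
    (hS : MeasurableSet S) (hSe : S ⊆ extDom a b) {k : ℝ} (hk : 0 < k)
    (hS' : ∀ x ∈ S, k < u x) :
    volume S ≤ ENNReal.ofReal ((∫ x in S, u x ^ 2) / k ^ 2) := by
  have hi : IntegrableOn (fun x => u x ^ 2) S := hu.2.2.mono_set hSe
  rw [ENNReal.ofReal_div_of_pos (by positivity), ofReal_integral_eq_lintegral_ofReal hi
    (Eventually.of_forall fun x => sq_nonneg _)]
  rw [ENNReal.le_div_iff_mul_le (Or.inl (by simpa using hk.ne')) (Or.inl ENNReal.ofReal_ne_top),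
    mul_comm, ← setLIntegral_const]
  refine setLIntegral_mono' hS fun x hx => ENNReal.ofReal_le_ofReal ?_
  have := hS' x hx
  gcongr

lemma measure_superlevel_ne_top (hu : MemH a b u) (hm : Measurable u) {k : ℝ} (hk : 0 < k) :
    volume (superlevel a b u k) ≠ ⊤ :=
  ne_top_of_le_ne_top ENNReal.ofReal_ne_top (measure_le_integral_sq_div hu
    (measurableSet_superlevel hm k) inter_subset_left hk fun _ hx => hx.2)

lemma superlevel_energy_le (hu : MemH a b u) (hm : Measurable u) {k h : ℝ} (hk : 0 < k)
    (hkh : k ≤ h) :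
    (h - k) ^ 2 * volume.real (superlevel a b u h) ≤ 4 * volume.real (superlevel a b u k) *
      ∫ z in extSq a b, diffQuot (fun x => max (u x - k) 0) (fun x => max (u x - k) 0) z := by
  refine sq_mul_measure_le_energy (hu.posPart_sub hk.le) (measurableSet_superlevel hm h)
    (measurableSet_superlevel hm k) (superlevel_anti hkh) inter_subset_left
    (measure_superlevel_ne_top hu hm hk) (by linarith) (fun x hx => ?_) (fun x hx hxn => ?_)
  · have : h < u x := hx.2
    exact le_max_of_le_left (by linarith)
  · have : ¬ k < u x := fun h => hxn ⟨hx, h⟩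
    exact max_eq_right (by linarith)

/-! ### Stampacchia iteration -/

/-- Stampacchia's iteration lemma. -/
lemma eq_zero_of_stampacchia {μ : ℝ → ℝ} {k₀ d B : ℝ} (hd : 0 < d)
    (hμ : ∀ k, k₀ ≤ k → 0 ≤ μ k) (hanti : ∀ k h, k₀ ≤ k → k ≤ h → μ h ≤ μ k)
    (hB : ∀ k h, k₀ ≤ k → k < h → ((h - k) ^ 2 * μ h) ^ 2 ≤ B * μ k ^ 3)
    (hsmall : B * μ k₀ ≤ (d ^ 2 / 64) ^ 2) : μ (k₀ + d) = 0 := by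
  -- The gaps of these levels are `d 2⁻ⁿ / 2`, so `(h - k)⁴` costs a factor `16⁻ⁿ`. The cube on the
  -- right, against the square on the left, gains exactly that when `μ` decays like `16⁻ⁿ`. The
  -- induction closes at the threshold `d⁴ / 16³ = (d² / 64)²`.
  have hstep : ∀ n : ℕ, μ (k₀ + d * (1 - (1 / 2) ^ n)) ≤ μ k₀ * (1 / 16) ^ n := by
    intro n
    induction n with
    | zero => simp
    | succ n ih =>
      have hp : (0 : ℝ) < (1 / 2) ^ n := by positivity
      have hp1 : ((1 : ℝ) / 2) ^ n ≤ 1 := pow_le_one₀ (by norm_num) (by norm_num)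
      set k := k₀ + d * (1 - (1 / 2) ^ n) with hk
      set h := k₀ + d * (1 - (1 / 2) ^ (n + 1)) with hh
      have hdiff : h - k = d * (1 / 2) ^ n / 2 := by rw [hk, hh, pow_succ]; ring
      have hkk : k₀ ≤ k := by rw [hk]; nlinarith
      have hkh : k < h := by have : 0 < h - k := by rw [hdiff]; positivity
                             linarith
      have h1 := hB k h hkk hkh
      have hk0 : 0 ≤ μ k := hμ k hkk
      have h00 : 0 ≤ μ k₀ := hμ k₀ le_rfl
      have hh0 : 0 ≤ μ h := hμ h (hkk.trans hkh.le)
      have hBk : B * μ k ^ 3 ≤ (d ^ 2 / 64) ^ 2 * (1 / 16) ^ n * (μ k₀ * (1 / 16) ^ n) ^ 2 := by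
        rcases le_total 0 B with hB0 | hB0
        · calc B * μ k ^ 3 ≤ B * (μ k₀ * (1 / 16) ^ n) ^ 3 := by gcongr
            _ = (B * μ k₀) * (1 / 16) ^ n * (μ k₀ * (1 / 16) ^ n) ^ 2 := by ring
            _ ≤ _ := by gcongr
        · refine (mul_nonpos_of_nonpos_of_nonneg hB0 (by positivity)).trans (by positivity)
      have h16 : ((1 : ℝ) / 16) ^ n = (((1 : ℝ) / 2) ^ n) ^ 4 := by
        rw [← pow_mul, mul_comm, pow_mul]; norm_num
      have h2 : ((h - k) ^ 2 * μ h) ^ 2 ≤ ((h - k) ^ 2 * (μ k₀ * (1 / 16) ^ (n + 1))) ^ 2 := by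
        refine (h1.trans hBk).trans (le_of_eq ?_)
        rw [hdiff, pow_succ (1 / 16 : ℝ) n, h16]
        ring
      have hpos : 0 < (h - k) ^ 2 := by rw [hdiff]; positivity
      have h3 := (pow_le_pow_iff_left₀ (by positivity) (by positivity) two_ne_zero).1 h2
      exact le_of_mul_le_mul_left h3 hpos
  have hle : ∀ n : ℕ, μ (k₀ + d) ≤ μ k₀ * (1 / 16) ^ n := fun n => by
    have hp : (0 : ℝ) < (1 / 2) ^ n := by positivity
    have hp1 : ((1 : ℝ) / 2) ^ n ≤ 1 := pow_le_one₀ (by norm_num) (by norm_num)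
    exact (hanti _ _ (by nlinarith) (by nlinarith)).trans (hstep n)
  have hlim : Tendsto (fun n : ℕ => μ k₀ * (1 / 16 : ℝ) ^ n) atTop (𝓝 (μ k₀ * 0)) :=
    (tendsto_pow_atTop_nhds_zero_of_lt_one (by norm_num) (by norm_num)).const_mul _
  rw [mul_zero] at hlim
  exact le_antisymm (ge_of_tendsto' hlim hle) (hμ _ (by linarith))

/-! ### Slicing, Gaussian decay and exponential integrability -/

/-- The part of `t` between the levels `k` and `h`. -/
def slice (k h t : ℝ) : ℝ := max (min t h - k) 0

lemma slice_eq {k h : ℝ} (hkh : k ≤ h) (t : ℝ) : slice k h t = min t h - min t k := by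
  unfold slice; grind

lemma lipschitzWith_slice (k h : ℝ) : LipschitzWith 1 (slice k h) := by
  have := (lipschitzWith_posPart_sub k).comp (LipschitzWith.id.min_const h)
  rw [one_mul] at this
  exact this

lemma monotone_slice (k h : ℝ) : Monotone (slice k h) :=
  fun _ _ hst => max_le_max (sub_le_sub_right (min_le_min hst le_rfl) _) le_rfl

lemma MemH.slice (hu : MemH a b u) {k : ℝ} (hk : 0 ≤ k) (h : ℝ) :
    MemH a b (fun x => slice k h (u x)) :=
  hu.comp (lipschitzWith_slice k h)
    (max_eq_right (by linarith [min_le_left (0 : ℝ) h]))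

/-- For `t ≤ s` the slice increments are nonnegative and telescope, so their squares sum to at most
the square of the total increment. This makes the energies of the slices superadditive. -/
lemma sum_slice_sq_le {κ : ℕ → ℝ} (hκ : Monotone κ) (m : ℕ) (s t : ℝ) :
    ∑ j ∈ Finset.range m, (slice (κ j) (κ (j + 1)) s - slice (κ j) (κ (j + 1)) t) ^ 2
      ≤ (max (s - κ 0) 0 - max (t - κ 0) 0) ^ 2 := by
  wlog hst : t ≤ s generalizing s t
  · have := this t s (le_of_not_ge hst)
    calc _ = ∑ j ∈ Finset.range m,
          (slice (κ j) (κ (j + 1)) t - slice (κ j) (κ (j + 1)) s) ^ 2 :=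
          Finset.sum_congr rfl fun j _ => by ring
      _ ≤ _ := this
      _ = _ := by ring
  refine (Finset.sum_sq_le_sq_sum_of_nonneg
    fun j _ => sub_nonneg.2 (monotone_slice _ _ hst)).trans ?_
  have hsum : ∀ r : ℝ, ∑ j ∈ Finset.range m, slice (κ j) (κ (j + 1)) r
      = min r (κ m) - min r (κ 0) := fun r => by
    rw [← Finset.sum_range_sub (fun j => min r (κ j))]
    exact Finset.sum_congr rfl fun j _ => slice_eq (hκ (Nat.le_succ j)) r
  rw [Finset.sum_sub_distrib, hsum, hsum]
  have h0 : κ 0 ≤ κ m := hκ (Nat.zero_le m)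
  refine pow_le_pow_left₀ ?_ ?_ 2
  · grind
  · grind

lemma sum_slice_energy_le (hu : MemH a b u) {κ : ℕ → ℝ} (hκ : Monotone κ) (h0 : 0 ≤ κ 0) (m : ℕ) :
    ∑ j ∈ Finset.range m, ∫ z in extSq a b, diffQuot (fun x => slice (κ j) (κ (j + 1)) (u x))
        (fun x => slice (κ j) (κ (j + 1)) (u x)) z
      ≤ ∫ z in extSq a b, diffQuot (fun x => max (u x - κ 0) 0)
        (fun x => max (u x - κ 0) 0) z := by
  have hs : ∀ j, MemH a b (fun x => slice (κ j) (κ (j + 1)) (u x)) := fun j =>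
    hu.slice (h0.trans (hκ (Nat.zero_le j))) _
  rw [← integral_finsetSum _ fun j _ => (hs j).2.1]
  refine integral_mono (integrable_finsetSum _ fun j _ => (hs j).2.1) (hu.posPart_sub h0).2.1
    fun z => ?_
  simp only [diffQuot]
  rw [← Finset.sum_div]
  refine div_le_div_of_nonneg_right ?_ (by positivity)
  simp only [← pow_two]
  exact sum_slice_sq_le hκ m _ _

/-- Iterating leaves the product of the `c * e j`. The bound `1 + x ≤ exp x`, applied to each factor
divided by `η`, replaces that product by an expression in the sum of the `e j`, as in the
arithmetic-geometric mean inequality. -/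
lemma le_of_recursive_bound {μ e : ℕ → ℝ} {c η : ℝ} (hμ : ∀ j, 0 ≤ μ j)
    (hη : 0 < η) (h : ∀ j, μ (j + 1) ≤ c * e j * μ j) (m : ℕ) :
    μ m ≤ μ 0 * η ^ m * Real.exp (c * (∑ j ∈ Finset.range m, e j) / η - m) := by
  induction m with
  | zero => simp
  | succ m ih =>
    have h1 : c * e m ≤ η * Real.exp (c * e m / η - 1) := by
      have := Real.add_one_le_exp (c * e m / η - 1)
      calc c * e m = η * (c * e m / η - 1 + 1) := by field_simp; ring
        _ ≤ _ := by gcongr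
    calc μ (m + 1) ≤ c * e m * μ m := h m
      _ ≤ η * Real.exp (c * e m / η - 1) * μ m := mul_le_mul_of_nonneg_right h1 (hμ m)
      _ ≤ η * Real.exp (c * e m / η - 1) *
          (μ 0 * η ^ m * Real.exp (c * (∑ j ∈ Finset.range m, e j) / η - m)) := by gcongr
      _ = μ 0 * η ^ (m + 1) * (Real.exp (c * (∑ j ∈ Finset.range m, e j) / η - m)
          * Real.exp (c * e m / η - 1)) := by ring
      _ = _ := by
        rw [← Real.exp_add, Finset.sum_range_succ]
        congr 2
        push_cast
        ring

/-- Superlevel sets of functions of finite energy have Gaussian decay. -/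
lemma measure_superlevel_add_nat_le (hu : MemH a b u) (hm : Measurable u) {k₀ η : ℝ} (hk₀ : 0 < k₀)
    (hη : 0 < η) (hE : 4 * ∫ z in extSq a b, diffQuot (fun x => max (u x - k₀) 0)
        (fun x => max (u x - k₀) 0) z ≤ η) (n : ℕ) :
    volume.real (superlevel a b u (k₀ + n))
      ≤ volume.real (superlevel a b u k₀) * η ^ (n ^ 2) := by
  rcases Nat.eq_zero_or_pos n with rfl | hn
  · simp
  have hn' : (0 : ℝ) < n := by exact_mod_cast hn
  -- There are `n²` slices of height `1 / n`. Each step has constant `4 n²`, and four times the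
  -- total energy is at most `η`, so the exponent in `le_of_recursive_bound` is at most `n² - n² =
  -- 0`.
  set κ : ℕ → ℝ := fun j => k₀ + j / n with hκdef
  have hκ : Monotone κ := fun i j hij => by
    have : (i : ℝ) ≤ j := by exact_mod_cast hij
    simp only [hκdef]; gcongr
  have hκ0 : κ 0 = k₀ := by simp [hκdef]
  have hκpos : ∀ j, 0 < κ j := fun j => by simp only [hκdef]; positivity
  set e : ℕ → ℝ := fun j => ∫ z in extSq a b, diffQuot (fun x => slice (κ j) (κ (j + 1)) (u x))
        (fun x => slice (κ j) (κ (j + 1)) (u x)) z with he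
  have hstep : ∀ j, volume.real (superlevel a b u (κ (j + 1)))
      ≤ (4 * (n : ℝ) ^ 2) * e j * volume.real (superlevel a b u (κ j)) := fun j => by
    have h1 := sq_mul_measure_le_energy (hu.slice (hκpos j).le (κ (j + 1)))
      (measurableSet_superlevel hm (κ (j + 1))) (measurableSet_superlevel hm (κ j))
      (superlevel_anti (hκ (Nat.le_succ j))) inter_subset_left
      (measure_superlevel_ne_top hu hm (hκpos j)) (d := 1 / n) (by positivity)
      (fun x hx => ?_) (fun x hx hxn => ?_)
    · have h2 : (1 / (n : ℝ)) ^ 2 * volume.real (superlevel a b u (κ (j + 1)))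
          ≤ 4 * volume.real (superlevel a b u (κ j)) * e j := h1
      calc _ = (n : ℝ) ^ 2 *
            ((1 / (n : ℝ)) ^ 2 * volume.real (superlevel a b u (κ (j + 1)))) := by field_simp
        _ ≤ (n : ℝ) ^ 2 * (4 * volume.real (superlevel a b u (κ j)) * e j) := by gcongr
        _ = _ := by ring
    · have h3 : κ (j + 1) < u x := hx.2
      refine le_max_of_le_left ?_
      rw [min_eq_right h3.le]
      simp only [hκdef]
      push_cast
      exact le_of_eq (by ring)
    · have h3 : ¬ κ j < u x := fun h => hxn ⟨hx, h⟩
      exact max_eq_right (by linarith [min_le_left (u x) (κ (j + 1))])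
  have hb := le_of_recursive_bound (μ := fun j => volume.real (superlevel a b u (κ j))) (e := e)
    (fun j => measureReal_nonneg) hη hstep (n ^ 2)
  have hsum := sum_slice_energy_le hu hκ (hκpos 0).le (n ^ 2)
  have hκn : κ (n ^ 2) = k₀ + n := by
    simp only [hκdef]; push_cast; field_simp
  simp only [hκn, hκ0] at hb hsum
  refine hb.trans ?_
  refine mul_le_of_le_one_right (mul_nonneg measureReal_nonneg (by positivity)) ?_
  rw [Real.exp_le_one_iff, sub_nonpos, div_le_iff₀ hη]
  have h4 : 4 * ∑ j ∈ Finset.range (n ^ 2), e j ≤ η := by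
    refine le_trans ?_ hE
    exact mul_le_mul_of_nonneg_left hsum (by norm_num)
  push_cast
  nlinarith [sq_nonneg (n : ℝ)]

lemma tendsto_energy_posPart_sub (hu : MemH a b u) :
    Tendsto (fun n : ℕ => ∫ z in extSq a b, diffQuot (fun x => max (u x - n) 0)
        (fun x => max (u x - n) 0) z) atTop (𝓝 0) := by
  have : Tendsto (fun n : ℕ => ∫ z in extSq a b, diffQuot (fun x => max (u x - n) 0)
        (fun x => max (u x - n) 0) z) atTop (𝓝 (∫ _ in extSq a b, (0 : ℝ))) := by
    refine tendsto_integral_of_dominated_convergence (diffQuot u u)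
      (fun n => (hu.posPart_sub (Nat.cast_nonneg n)).2.1.aestronglyMeasurable) hu.2.1
      (fun n => Eventually.of_forall fun z => ?_) (Eventually.of_forall fun z => ?_)
    · rw [Real.norm_eq_abs, abs_of_nonneg (diffQuot_self_nonneg _ z)]
      exact diffQuot_comp_le (lipschitzWith_posPart_sub n) u z
    · refine tendsto_const_nhds.congr' ?_
      filter_upwards [eventually_ge_atTop ⌈max (u z.1) (u z.2)⌉₊] with n hn
      have h1 : max (u z.1) (u z.2) ≤ n := (Nat.le_ceil _).trans (by exact_mod_cast hn)
      have h2 : max (u z.1 - n) 0 = 0 := max_eq_right (by linarith [le_max_left (u z.1) (u z.2)])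
      have h3 : max (u z.2 - n) 0 = 0 := max_eq_right (by linarith [le_max_right (u z.1) (u z.2)])
      simp [diffQuot, h2, h3]
  simpa using this

/-- Exponential integrability of functions of finite energy. -/
lemma exists_integrableOn_exp (hu : MemH a b u) (hm : Measurable u) {c : ℝ} (hc : 0 < c) :
    ∃ k₀ : ℝ, 0 < k₀ ∧ IntegrableOn (fun x => Real.exp (c * u x ^ 2)) (superlevel a b u k₀) := by
  -- Since `c (k₀ + 1 + n)² ≤ 2c (k₀ + 1)² + 2c n²`, this `η` leaves `exp (-n²) ≤ exp (-n)` on the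
  -- layer between `k₀ + n` and `k₀ + n + 1`, which is summable.
  have hη : 0 < Real.exp (-(2 * c + 1)) := Real.exp_pos _
  have hev := (tendsto_energy_posPart_sub hu).eventually
    (gt_mem_nhds (show (0 : ℝ) < Real.exp (-(2 * c + 1)) / 4 by positivity))
  obtain ⟨N, hN, hN1⟩ := (hev.and (eventually_ge_atTop 1)).exists
  have hk₀ : (0 : ℝ) < N := by exact_mod_cast hN1
  set k₀ : ℝ := (N : ℝ)
  refine ⟨k₀, hk₀, ?_⟩
  have htail := measure_superlevel_add_nat_le hu hm hk₀ hη (by linarith)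
  refine ⟨(by fun_prop : Measurable fun x => Real.exp (c * u x ^ 2)).aestronglyMeasurable, ?_⟩
  rw [hasFiniteIntegral_iff_ofReal (Eventually.of_forall fun x => (Real.exp_pos _).le)]
  set S : ℕ → Set ℝ := fun n => superlevel a b u (k₀ + n) ∩ {x | u x ≤ k₀ + n + 1} with hS
  have hSm : ∀ n, MeasurableSet (S n) := fun n =>
    (measurableSet_superlevel hm _).inter (measurableSet_le hm measurable_const)
  have hcover : superlevel a b u k₀ ⊆ ⋃ n, S n := fun x hx => by
    have hx2 : k₀ < u x := hx.2
    have h0 : 0 < ⌈u x - k₀⌉₊ := Nat.ceil_pos.2 (by linarith)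
    have h1 := Nat.le_ceil (u x - k₀)
    have h2 := Nat.ceil_lt_add_one (by linarith : 0 ≤ u x - k₀)
    obtain ⟨n, hn⟩ := Nat.exists_eq_succ_of_ne_zero h0.ne'
    rw [hn] at h1 h2
    push_cast at h1 h2
    exact mem_iUnion.2 ⟨n, ⟨hx.1, show k₀ + n < u x by linarith⟩,
      show u x ≤ k₀ + n + 1 by linarith⟩
  set M := volume.real (superlevel a b u k₀)
  set K := M * Real.exp (2 * c * (k₀ + 1) ^ 2)
  have hpiece : ∀ n, ∫⁻ x in S n, ENNReal.ofReal (Real.exp (c * u x ^ 2))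
      ≤ ENNReal.ofReal (K * Real.exp (-n)) := fun n => by
    have hfin : volume (superlevel a b u (k₀ + n)) ≠ ⊤ :=
      measure_superlevel_ne_top hu hm (by positivity)
    calc ∫⁻ x in S n, ENNReal.ofReal (Real.exp (c * u x ^ 2))
        ≤ ∫⁻ x in S n, ENNReal.ofReal (Real.exp (c * (k₀ + n + 1) ^ 2)) := by
          refine setLIntegral_mono' (hSm n) fun x hx => ENNReal.ofReal_le_ofReal ?_
          have h1 : k₀ + n < u x := hx.1.2
          have h2 : u x ≤ k₀ + n + 1 := hx.2
          have h3 : 0 ≤ u x := by linarith [(Nat.cast_nonneg n : (0 : ℝ) ≤ n)]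
          gcongr
      _ = ENNReal.ofReal (Real.exp (c * (k₀ + n + 1) ^ 2)) * volume (S n) := by
          rw [setLIntegral_const]
      _ ≤ ENNReal.ofReal (Real.exp (c * (k₀ + n + 1) ^ 2)) *
          volume (superlevel a b u (k₀ + n)) := by gcongr; exact inter_subset_left
      _ = ENNReal.ofReal (Real.exp (c * (k₀ + n + 1) ^ 2) *
          volume.real (superlevel a b u (k₀ + n))) := by
          rw [ENNReal.ofReal_mul (Real.exp_pos _).le, measureReal_def, ENNReal.ofReal_toReal hfin]
      _ ≤ ENNReal.ofReal (K * Real.exp (-n)) := by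
          refine ENNReal.ofReal_le_ofReal ?_
          calc _ ≤ Real.exp (c * (k₀ + n + 1) ^ 2) *
                (M * Real.exp (-(2 * c + 1)) ^ (n ^ 2)) := by gcongr; exact htail n
            _ = M * Real.exp (c * (k₀ + n + 1) ^ 2 + ((n ^ 2 : ℕ) : ℝ) * (-(2 * c + 1))) := by
                rw [Real.exp_add, ← Real.exp_nat_mul]; ring
            _ ≤ M * Real.exp (2 * c * (k₀ + 1) ^ 2 + -n) := by
                refine mul_le_mul_of_nonneg_left (Real.exp_le_exp.2 ?_) measureReal_nonneg
                have hn2 : (n : ℝ) ≤ n ^ 2 := by exact_mod_cast Nat.le_self_pow two_ne_zero n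
                push_cast
                nlinarith [mul_nonneg hc.le (sq_nonneg (k₀ + 1 - n))]
            _ = K * Real.exp (-n) := by rw [Real.exp_add]; ring
  calc _ ≤ ∫⁻ x in ⋃ n, S n, ENNReal.ofReal (Real.exp (c * u x ^ 2)) := lintegral_mono_set hcover
    _ ≤ ∑' n, ∫⁻ x in S n, ENNReal.ofReal (Real.exp (c * u x ^ 2)) := lintegral_iUnion_le _ _
    _ ≤ ∑' n : ℕ, ENNReal.ofReal (K * Real.exp (-n)) := ENNReal.tsum_le_tsum hpiece
    _ < ⊤ := (Real.summable_exp_neg_nat.mul_left K).tsum_ofReal_lt_top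

/-! ### Boundedness of weak solutions -/

/-- Cauchy–Schwarz against the constant `1`, read off from the nonnegative integral of the squared
deviation of `h` from its mean `A / M`. -/
lemma sq_integral_le_measure_mul {S : Set ℝ} (hS : volume S ≠ ⊤) {h : ℝ → ℝ} (hh : Measurable h)
    (h2 : IntegrableOn (fun x => h x ^ 2) S) :
    IntegrableOn h S ∧ (∫ x in S, h x) ^ 2 ≤ volume.real S * ∫ x in S, h x ^ 2 := by
  have hfin : IsFiniteMeasure (volume.restrict S) := isFiniteMeasure_restrict.2 hS
  have hone : ∀ c : ℝ, IntegrableOn (fun _ : ℝ => c) S := fun c => integrable_const c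
  have h1 : IntegrableOn h S := by
    refine ((hone 1).add h2).mono' hh.aestronglyMeasurable (Eventually.of_forall fun x => ?_)
    rw [Real.norm_eq_abs, abs_le]
    constructor <;> simp only [Pi.add_apply] <;> nlinarith [sq_nonneg (h x - 1), sq_nonneg (h x + 1)]
  refine ⟨h1, ?_⟩
  rcases (measureReal_nonneg (μ := volume) (s := S)).eq_or_lt with hM | hM
  · have : volume S = 0 := by
      rw [measureReal_def, eq_comm, ENNReal.toReal_eq_zero_iff] at hM
      exact hM.resolve_right hS
    simp [Measure.restrict_eq_zero.2 this]
  set M := volume.real S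
  set A := ∫ x in S, h x
  have h0 : 0 ≤ ∫ x in S, (h x - A / M) ^ 2 := integral_nonneg fun x => sq_nonneg _
  have he : ∫ x in S, (h x - A / M) ^ 2 = (∫ x in S, h x ^ 2) - A ^ 2 / M := by
    have hcm : IntegrableOn (fun x => 2 * (A / M) * h x) S := h1.const_mul _
    have hsub : IntegrableOn (fun x => h x ^ 2 - 2 * (A / M) * h x) S := h2.sub hcm
    calc ∫ x in S, (h x - A / M) ^ 2
        = ∫ x in S, (h x ^ 2 - 2 * (A / M) * h x + (A / M) ^ 2) := by
          congr 1; ext x; ring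
      _ = (∫ x in S, h x ^ 2) - 2 * (A / M) * A + M * (A / M) ^ 2 := by
          rw [integral_add hsub (hone _), integral_sub h2 hcm, integral_const_mul]
          rw [setIntegral_const, smul_eq_mul]
      _ = _ := by field_simp; ring
  rw [he, sub_nonneg, div_le_iff₀ hM] at h0
  linarith

lemma memH_zero : MemH a b (fun _ => 0) := by
  refine ⟨aemeasurable_const, ?_, ?_⟩
  · have : diffQuot (fun _ => 0) (fun _ => 0) = fun _ => (0 : ℝ) := by ext z; simp [diffQuot]
    rw [this]; exact integrableOn_zero
  · simp

/-- The energy of the part of a weak solution above level `k`. -/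
lemma IsWeakSolution.energy_posPart_le {Q g : ℝ → ℝ} (hu : IsWeakSolution a b Q g u) {k : ℝ}
    (hk : 0 ≤ k) :
    (∫ z in extSq a b, diffQuot (fun x => max (u x - k) 0) (fun x => max (u x - k) 0) z)
      ≤ 2 * Real.pi * ∫ x in extDom a b, Q x * g (u x) * max (u x - k) 0 := by
  have h := hu.comparison memH_zero hk
  simp only [sub_zero] at h
  have hz : ∫ z in extSq a b, diffQuot (fun _ => 0) (fun x => max (u x - k) 0) z = 0 := by
    simp [diffQuot]
  have hp : 0 ≤ ∫ x in extDom a b, u x * max (u x - k) 0 := by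
    refine integral_nonneg fun x => ?_
    simp only [Pi.zero_apply]
    rcases le_total (u x) k with h | h
    · rw [max_eq_right (by linarith)]; simp
    · exact mul_nonneg (hk.trans h) (le_max_right _ _)
  rw [hz, mul_zero, add_zero] at h
  have h' := (le_add_of_nonneg_right hp).trans h
  rw [one_div, inv_mul_le_iff₀ (by positivity)] at h'
  exact h'

/-- Weak solutions with nonlinearity of critical exponential growth are bounded. -/
lemma IsWeakSolution.exists_ae_le {Q g : ℝ → ℝ} (hu : IsWeakSolution a b Q g u) (hm : Measurable u)
    {Qm : ℝ} (hQ0 : ∀ x ∈ extDom a b, 0 ≤ Q x) (hQm : ∀ x ∈ extDom a b, Q x ≤ Qm)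
    (hg0 : ∀ s, 0 ≤ g s) {C : ℝ} (hg : ∀ s, g s ≤ C * Real.exp (Real.pi * s ^ 2)) :
    ∃ K : ℝ, 0 < K ∧ ∀ᵐ x, u x ≤ K := by
  have hC : 0 ≤ C := by simpa using (hg0 0).trans (hg 0)
  have hQm0 : 0 ≤ Qm := by
    have : a ∈ extDom a b := fun h => lt_irrefl _ h.1
    exact (hQ0 a this).trans (hQm a this)
  -- The growth of `g` uses `exp (π u²)`, an extra `exp (u²)` absorbs the test function `(u - k)⁺`,
  -- and the factor `2` allows Cauchy–Schwarz.
  obtain ⟨k₀, hk₀, hint⟩ := exists_integrableOn_exp hu.1 hm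
    (show 0 < 2 * (Real.pi + 1) by positivity)
  set μ : ℝ → ℝ := fun k => volume.real (superlevel a b u k) with hμ
  set I := ∫ x in superlevel a b u k₀, Real.exp (2 * (Real.pi + 1) * u x ^ 2) with hI
  set h : ℝ → ℝ := fun x => Real.exp ((Real.pi + 1) * u x ^ 2) with hh
  have hhm : Measurable h := by fun_prop
  have hh2 : ∀ x, h x ^ 2 = Real.exp (2 * (Real.pi + 1) * u x ^ 2) := fun x => by
    rw [hh, ← Real.exp_nat_mul]; congr 1; push_cast; ring
  have hRHS : ∀ k, k₀ ≤ k → (∫ x in extDom a b, Q x * g (u x) * max (u x - k) 0)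
      ≤ Qm * C * ∫ x in superlevel a b u k, h x := fun k hk => by
    have hS := measurableSet_superlevel (a := a) (b := b) hm k
    have hi : IntegrableOn (fun x => h x ^ 2) (superlevel a b u k) := by
      simp only [hh2]; exact hint.mono_set (superlevel_anti hk)
    have hcs := (sq_integral_le_measure_mul
      (measure_superlevel_ne_top hu.1 hm (hk₀.trans_le hk)) hhm hi).1
    have e1 : Qm * C * ∫ x in superlevel a b u k, h x
        = ∫ x in extDom a b, (superlevel a b u k).indicator (fun x => Qm * C * h x) x := by
      rw [setIntegral_indicator hS, inter_eq_right.2 (show superlevel a b u k ⊆ extDom a b from inter_subset_left),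
        integral_const_mul]
    rw [e1]
    refine integral_mono_of_nonneg ?_ ?_ ?_
    · refine (ae_restrict_iff' measurableSet_extDom).2 (Eventually.of_forall fun x hx => ?_)
      exact mul_nonneg (mul_nonneg (hQ0 x hx) (hg0 _)) (le_max_right _ _)
    · rw [integrable_indicator_iff hS]
      exact ((hcs.const_mul (Qm * C)).mono_measure
        (Measure.restrict_mono_measure Measure.restrict_le_self _))
    · refine (ae_restrict_iff' measurableSet_extDom).2 (Eventually.of_forall fun x hx => ?_)
      by_cases hxk : k < u x
      · simp only []
        rw [indicator_of_mem (show x ∈ superlevel a b u k from ⟨hx, hxk⟩)]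
        have hkp : 0 < k := hk₀.trans_le hk
        have hu1 : max (u x - k) 0 ≤ Real.exp (u x ^ 2) := by
          refine max_le ?_ (Real.exp_pos _).le
          have := Real.add_one_le_exp (u x ^ 2)
          nlinarith [sq_nonneg (u x - 1)]
        calc Q x * g (u x) * max (u x - k) 0
            ≤ Qm * (C * Real.exp (Real.pi * u x ^ 2)) * Real.exp (u x ^ 2) := by
              have h1 := hQm x hx
              have h2 := hg (u x)
              have h3 := hg0 (u x)
              have h4 := le_max_right (u x - k) 0
              gcongr
          _ = Qm * C * (Real.exp (Real.pi * u x ^ 2) * Real.exp (u x ^ 2)) := by ring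
          _ = Qm * C * h x := by
              rw [← Real.exp_add, hh]; congr 2; ring
      · simp only []
        rw [max_eq_right (by linarith), mul_zero]
        exact indicator_nonneg (fun x _ => by positivity) x
  set B := 16 * (2 * Real.pi * (Qm * C)) ^ 2 * I with hB
  have hI0 : 0 ≤ I := integral_nonneg fun x => (Real.exp_pos _).le
  have hB0 : 0 ≤ B := by positivity
  -- The isoperimetric inequality gives one factor `μ k`. The energy, bounded by the nonlinear term,
  -- gives a further `(μ k)^{1/2}` by Cauchy–Schwarz. The total power `3/2` exceeds `1`, as the
  -- iteration requires.
  have hmain : ∀ k l, k₀ ≤ k → k < l → ((l - k) ^ 2 * μ l) ^ 2 ≤ B * μ k ^ 3 := by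
    intro k l hk hkl
    have hkp : 0 < k := hk₀.trans_le hk
    have hi : IntegrableOn (fun x => h x ^ 2) (superlevel a b u k) := by
      simp only [hh2]; exact hint.mono_set (superlevel_anti hk)
    have hcs := (sq_integral_le_measure_mul (measure_superlevel_ne_top hu.1 hm hkp) hhm hi).2
    have hII : ∫ x in superlevel a b u k, h x ^ 2 ≤ I := by
      simp only [hh2]
      exact setIntegral_mono_set hint (Eventually.of_forall fun x => (Real.exp_pos _).le)
        (superlevel_anti hk).eventuallyLE
    have h1 := superlevel_energy_le hu.1 hm hkp hkl.le
    have h2 := hu.energy_posPart_le hkp.le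
    have h3 := hRHS k hk
    set J := ∫ x in superlevel a b u k, h x
    have hμ0 : 0 ≤ μ k := measureReal_nonneg
    have h4 : (l - k) ^ 2 * μ l ≤ 4 * μ k * (2 * Real.pi * (Qm * C * J)) := by
      refine h1.trans ?_
      refine mul_le_mul_of_nonneg_left ?_ (by positivity)
      exact h2.trans (by gcongr)
    have h5 : J ^ 2 ≤ μ k * I := hcs.trans (by gcongr)
    have hμl : 0 ≤ μ l := measureReal_nonneg
    calc ((l - k) ^ 2 * μ l) ^ 2 ≤ (4 * μ k * (2 * Real.pi * (Qm * C * J))) ^ 2 := by gcongr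
      _ = 16 * (2 * Real.pi * (Qm * C)) ^ 2 * μ k ^ 2 * J ^ 2 := by ring
      _ ≤ 16 * (2 * Real.pi * (Qm * C)) ^ 2 * μ k ^ 2 * (μ k * I) := by gcongr
      _ = _ := by rw [hB]; ring
  have hanti : ∀ k l, k₀ ≤ k → k ≤ l → μ l ≤ μ k := fun k l hk hkl =>
    measureReal_mono (superlevel_anti hkl) (measure_superlevel_ne_top hu.1 hm (hk₀.trans_le hk))
  obtain ⟨k₁, hk₁, hsmall⟩ : ∃ k₁, k₀ ≤ k₁ ∧ B * μ k₁ ≤ ((1 : ℝ) ^ 2 / 64) ^ 2 := by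
    set N := ∫ x in extDom a b, u x ^ 2
    have hN : 0 ≤ N := integral_nonneg fun x => sq_nonneg _
    have hbd : ∀ k, k₀ ≤ k → μ k ≤ N / k ^ 2 := fun k hk => by
      have hkp : 0 < k := hk₀.trans_le hk
      refine ENNReal.toReal_le_of_le_ofReal (by positivity) ?_
      refine (measure_le_integral_sq_div hu.1 (measurableSet_superlevel hm k)
        inter_subset_left hkp fun _ hx => hx.2).trans (ENNReal.ofReal_le_ofReal ?_)
      gcongr
      exact setIntegral_mono_set hu.1.2.2 (Eventually.of_forall fun x => sq_nonneg _)
        inter_subset_left.eventuallyLE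
    have hlim : Tendsto (fun k : ℝ => B * (N / k ^ 2)) atTop (𝓝 (B * 0)) :=
      (tendsto_const_nhds.div_atTop (tendsto_pow_atTop two_ne_zero)).const_mul B
    rw [mul_zero] at hlim
    obtain ⟨k₁, h1, h2⟩ := ((hlim.eventually (gt_mem_nhds
      (show (0 : ℝ) < ((1 : ℝ) ^ 2 / 64) ^ 2 by positivity))).and (eventually_ge_atTop k₀)).exists
    exact ⟨k₁, h2, (mul_le_mul_of_nonneg_left (hbd k₁ h2) hB0).trans h1.le⟩
  have hz : μ (k₁ + 1) = 0 := eq_zero_of_stampacchia one_pos (fun k _ => measureReal_nonneg)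
    (fun k l hk => hanti k l (hk₁.trans hk)) (fun k l hk => hmain k l (hk₁.trans hk)) hsmall
  have hKpos : 0 < k₁ + 1 := by linarith
  refine ⟨k₁ + 1, hKpos, ?_⟩
  have hnull : volume (superlevel a b u (k₁ + 1)) = 0 := by
    exact ((ENNReal.toReal_eq_zero_iff _).1 hz).resolve_right (measure_superlevel_ne_top hu.1 hm hKpos)
  have hext : ∀ᵐ x, x ∈ extDom a b → max (u x - (k₁ + 1)) 0 = 0 := by
    filter_upwards [measure_eq_zero_iff_ae_notMem.1 hnull] with x hx hxe
    have : ¬ k₁ + 1 < u x := fun h => hx ⟨hxe, h⟩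
    exact max_eq_right (by linarith)
  -- So far the bound holds only on `extDom`. The nonlinear term now vanishes, hence so does the
  -- energy of the truncation, which extends the bound into `(a, b)`.
  have hE := hu.energy_posPart_le hKpos.le
  have hR0 : (∫ x in extDom a b, Q x * g (u x) * max (u x - (k₁ + 1)) 0) = 0 := by
    refine integral_eq_zero_of_ae ((ae_restrict_iff' measurableSet_extDom).2 ?_)
    filter_upwards [hext] with x hx hxe
    simp [hx hxe]
  rw [hR0, mul_zero] at hE
  filter_upwards [ae_eq_zero_of_energy_nonpos (hu.1.posPart_sub hKpos.le) hext hE] with x hx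
  have : u x - (k₁ + 1) ≤ max (u x - (k₁ + 1)) 0 := le_max_left _ _
  simp only [Pi.zero_apply] at hx
  linarith

/-! ### The barrier and its half-Laplacian -/

/-- The barrier function `1 / (l² + x²)`. -/
noncomputable def barrier (l x : ℝ) : ℝ := (l ^ 2 + x ^ 2)⁻¹

lemma barrier_nonneg (l x : ℝ) : 0 ≤ barrier l x := by unfold barrier; positivity

lemma continuous_barrier {l : ℝ} (hl : 0 < l) : Continuous (barrier l) := by
  unfold barrier
  exact Continuous.inv₀ (by fun_prop) fun x => by positivity

lemma barrier_eq {l : ℝ} (hl : 0 < l) (x : ℝ) : barrier l x = (l ^ 2)⁻¹ * (1 + (x / l) ^ 2)⁻¹ := by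
  unfold barrier
  rw [← mul_inv]; congr 1; field_simp

lemma integrable_barrier {l : ℝ} (hl : 0 < l) : Integrable (barrier l) := by
  have : barrier l = fun x => (l ^ 2)⁻¹ * (1 + (x / l) ^ 2)⁻¹ := funext (barrier_eq hl)
  rw [this]
  exact (integrable_inv_one_add_sq.comp_div hl.ne').const_mul _

lemma integral_barrier {l : ℝ} (hl : 0 < l) : ∫ x, barrier l x = Real.pi / l := by
  simp only [barrier_eq hl]
  rw [integral_const_mul, Measure.integral_comp_div (fun x => (1 + x ^ 2)⁻¹),
    integral_univ_inv_one_add_sq, abs_of_pos hl, smul_eq_mul]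
  field_simp

lemma barrier_le_one {l : ℝ} (hl : 1 ≤ l) (x : ℝ) : barrier l x ≤ 1 :=
  inv_le_one_of_one_le₀ (by nlinarith [sq_nonneg x])

lemma memH_barrier {l : ℝ} (hl : 1 ≤ l) : MemH a b (barrier l) := by
  have hl0 : 0 < l := by linarith
  have hm := (continuous_barrier hl0).measurable.aemeasurable (μ := volume)
  refine ⟨hm, ?_, ?_⟩
  · have hi : Integrable (fun z : ℝ × ℝ => barrier l z.1 * barrier l z.2) volume :=
      (integrable_barrier hl0).mul_prod (integrable_barrier hl0)
    refine ((hi.const_mul 4).mono' (aemeasurable_diffQuot hm hm).aestronglyMeasurable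
      (Eventually.of_forall fun z => ?_)).integrableOn
    rw [Real.norm_eq_abs, abs_of_nonneg (diffQuot_self_nonneg _ z)]
    obtain ⟨x, y⟩ := z
    have hX : 1 ≤ l ^ 2 + x ^ 2 := by nlinarith [sq_nonneg x]
    have hY : 1 ≤ l ^ 2 + y ^ 2 := by nlinarith [sq_nonneg y]
    simp only [diffQuot, barrier, sq_abs]
    rcases eq_or_ne x y with rfl | hxy
    · simp; positivity
    have hs : x - y ≠ 0 := sub_ne_zero.2 hxy
    rw [div_le_iff₀ (by positivity)]
    -- The factor `y - x` cancels the singular kernel, and what remains is at most `4 w(x) w(y)`,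
    -- integrable on the plane.
    have e : (l ^ 2 + x ^ 2)⁻¹ - (l ^ 2 + y ^ 2)⁻¹
        = (l ^ 2 + x ^ 2)⁻¹ * (l ^ 2 + y ^ 2)⁻¹ * ((y - x) * (x + y)) := by
      field_simp; ring
    rw [e]
    have h1 : (l ^ 2 + x ^ 2)⁻¹ * (l ^ 2 + y ^ 2)⁻¹ * (x + y) ^ 2 ≤ 4 := by
      rw [← mul_inv, inv_mul_le_iff₀ (by positivity)]
      nlinarith [sq_nonneg (x - y), mul_nonneg (sub_nonneg.2 hX) (sub_nonneg.2 hY), sq_nonneg l]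
    calc _ = (l ^ 2 + x ^ 2)⁻¹ * (l ^ 2 + y ^ 2)⁻¹ * (x - y) ^ 2 *
          ((l ^ 2 + x ^ 2)⁻¹ * (l ^ 2 + y ^ 2)⁻¹ * (x + y) ^ 2) := by ring
      _ ≤ (l ^ 2 + x ^ 2)⁻¹ * (l ^ 2 + y ^ 2)⁻¹ * (x - y) ^ 2 * 4 := by gcongr
      _ = _ := by ring
  · refine ((integrable_barrier hl0).mono' (hm.pow_const 2).aestronglyMeasurable
      (Eventually.of_forall fun x => ?_)).integrableOn
    rw [Real.norm_eq_abs, abs_of_nonneg (by positivity)]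
    nlinarith [barrier_nonneg l x, barrier_le_one hl x]

/-- The two sides differ by an explicit nonnegative rational function. The factor `z²` cancels the
kernel `1 / z²`, leaving a bound integrable in `z`: each translate of `w` has integral `π / l`,
which produces `8π / l`. -/
lemma barrier_second_difference {l : ℝ} (hl : 0 < l) (x z : ℝ) :
    -4 * z ^ 2 * (barrier l x * (barrier l (x + z) + barrier l (x - z)))
      ≤ 2 * barrier l x - barrier l (x + z) - barrier l (x - z) := by
  unfold barrier
  have hA : 0 < l ^ 2 + x ^ 2 := by positivity
  have hP : 0 < l ^ 2 + (x + z) ^ 2 := by positivity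
  have hM : 0 < l ^ 2 + (x - z) ^ 2 := by positivity
  rw [← sub_nonneg]
  have e : 2 * (l ^ 2 + x ^ 2)⁻¹ - (l ^ 2 + (x + z) ^ 2)⁻¹ - (l ^ 2 + (x - z) ^ 2)⁻¹
      - -4 * z ^ 2 * ((l ^ 2 + x ^ 2)⁻¹ * ((l ^ 2 + (x + z) ^ 2)⁻¹ + (l ^ 2 + (x - z) ^ 2)⁻¹))
      = z ^ 2 * (10 * l ^ 2 + 2 * x ^ 2 + 10 * z ^ 2) *
        ((l ^ 2 + x ^ 2)⁻¹ * (l ^ 2 + (x + z) ^ 2)⁻¹ * (l ^ 2 + (x - z) ^ 2)⁻¹) := by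
    field_simp
    ring
  rw [e]
  positivity

lemma barrier_neg (l x : ℝ) : barrier l (-x) = barrier l x := by simp [barrier]

/-- In the weak sense `(-Δ)^{1/2} w ≥ -(4 / l) w` for the barrier `w`. -/
lemma le_integral_diffQuot_barrier {l : ℝ} (hl : 1 ≤ l) {φ : ℝ → ℝ} (hφm : Measurable φ)
    (hφ0 : ∀ x, 0 ≤ φ x) (hφ2 : Integrable (fun x => φ x ^ 2))
    (hint : Integrable (diffQuot (barrier l) φ) (volume : Measure (ℝ × ℝ))) :
    -(8 * Real.pi / l) * (∫ x, barrier l x * φ x) ≤ ∫ z, diffQuot (barrier l) φ z := by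
  have hl0 : 0 < l := by linarith
  set w := barrier l with hw
  have hwc : Continuous w := continuous_barrier hl0
  have hwφ : ∀ s, Integrable (fun x => w (x + s) * φ x) := fun s => by
    refine (((integrable_barrier hl0).comp_add_right s).add hφ2).mono'
      ((hwc.comp (continuous_id.add continuous_const)).measurable.mul hφm).aestronglyMeasurable
      (Eventually.of_forall fun x => ?_)
    rw [Real.norm_eq_abs, abs_of_nonneg (mul_nonneg (barrier_nonneg _ _) (hφ0 x))]
    have h1 := barrier_nonneg l (x + s)
    have h2 := barrier_le_one hl (x + s)
    simp only [Pi.add_apply]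
    nlinarith [sq_nonneg (barrier l (x + s) - φ x), hφ0 x]
  have hwφ0 : Integrable (fun x => w x * φ x) := by simpa using hwφ 0
  have hprod : Integrable (fun z : ℝ × ℝ => (w z.1 * φ z.1) * w z.2) (volume.prod volume) :=
    hwφ0.mul_prod (integrable_barrier hl0)
  have hprodI : ∫ z : ℝ × ℝ, (w z.1 * φ z.1) * w z.2 ∂(volume.prod volume)
      = (∫ x, w x * φ x) * (Real.pi / l) := by
    rw [integral_prod_mul (fun x => w x * φ x) w, integral_barrier hl0]
  -- In the new coordinates `z.1` is the displacement and `z.2` the base point, so the kernel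
  -- depends on `z.1` alone. The second map yields `w(z - x)`, which equals `w(x - z)` because `w`
  -- is even.
  have hT : MeasurePreserving (fun z : ℝ × ℝ => (z.2, z.2 + z.1)) (volume.prod volume)
      (volume.prod volume) := measurePreserving_prod_add_swap volume volume
  have hT' : MeasurePreserving (fun z : ℝ × ℝ => (z.2, -z.2 + z.1)) (volume.prod volume)
      (volume.prod volume) := measurePreserving_prod_neg_add_swap volume volume
  have hR1 := hT.integrable_comp_of_integrable hprod
  have hR2 := hT'.integrable_comp_of_integrable hprod
  have hI1 : ∫ z, ((fun z : ℝ × ℝ => (w z.1 * φ z.1) * w z.2) ∘ fun z : ℝ × ℝ => (z.2, z.2 + z.1)) z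
      ∂(volume.prod volume) = (∫ x, w x * φ x) * (Real.pi / l) := by
    rw [← hprodI]
    conv_rhs => rw [← hT.map_eq]
    rw [integral_map hT.aemeasurable (by rw [hT.map_eq]; exact hprod.aestronglyMeasurable)]
    rfl
  have hI2 : ∫ z, ((fun z : ℝ × ℝ => (w z.1 * φ z.1) * w z.2) ∘
      fun z : ℝ × ℝ => (z.2, -z.2 + z.1)) z
      ∂(volume.prod volume) = (∫ x, w x * φ x) * (Real.pi / l) := by
    rw [← hprodI]
    conv_rhs => rw [← hT'.map_eq]
    rw [integral_map hT'.aemeasurable (by rw [hT'.map_eq]; exact hprod.aestronglyMeasurable)]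
    rfl
  have hD : Integrable (diffQuot w φ ∘ fun z : ℝ × ℝ => (z.2, z.2 + z.1)) (volume.prod volume) :=
    hT.integrable_comp_of_integrable hint
  have hDI : ∫ z, diffQuot w φ z
      = ∫ z, (diffQuot w φ ∘ fun z : ℝ × ℝ => (z.2, z.2 + z.1)) z ∂(volume.prod volume) := by
    rw [Measure.volume_eq_prod]
    conv_lhs => rw [← hT.map_eq]
    rw [integral_map hT.aemeasurable (by rw [hT.map_eq]; exact hint.aestronglyMeasurable)]
    rfl
  have hR := (hR1.add hR2).const_mul (-4)
  have hRI : ∫ z, -4 * (((fun z : ℝ × ℝ => (w z.1 * φ z.1) * w z.2) ∘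
        fun z : ℝ × ℝ => (z.2, z.2 + z.1)) + ((fun z : ℝ × ℝ => (w z.1 * φ z.1) * w z.2) ∘
      fun z : ℝ × ℝ => (z.2, -z.2 + z.1))) z ∂(volume.prod volume)
      = -(8 * Real.pi / l) * (∫ x, w x * φ x) := by
    rw [integral_const_mul, integral_add' hR1 hR2, hI1, hI2]
    ring
  rw [hDI, ← hRI, integral_prod _ hR, integral_prod _ hD]
  refine integral_mono_ae hR.integral_prod_left hD.integral_prod_left ?_
  have hz0 : ∀ᵐ z : ℝ, z ≠ 0 := by simp [ae_iff]
  filter_upwards [hz0, hR.prod_right_ae] with z hz hRz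
  simp only [Pi.add_apply, Function.comp_apply]
  have hz2 : (0 : ℝ) < z ^ 2 := by positivity
  have hs1 := hwφ z
  have hs2 : Integrable (fun x => w (x - z) * φ x) := by simpa [sub_eq_add_neg] using hwφ (-z)
  -- For fixed `z ≠ 0` the two halves of the quotient are separately integrable; translating the one
  -- with `φ (x + z)` turns the first difference of `w` into a second difference against `φ x`.
  have hshift : ∫ x, (w x - w (x + z)) * φ (x + z) = ∫ x, (w (x - z) - w x) * φ x := by
    rw [← integral_add_right_eq_self (fun x => (w (x - z) - w x) * φ x) z]
    simp
  have hsi : Integrable (fun x => (w x - w (x + z)) * φ (x + z)) := by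
    have h := ((hs2.sub hwφ0).comp_add_right z)
    refine h.congr (Eventually.of_forall fun x => ?_)
    simp only [Pi.sub_apply, add_sub_cancel_right]
    ring
  have hsi0 : Integrable (fun x => (w x - w (x + z)) * φ x) := by
    refine (hwφ0.sub hs1).congr (Eventually.of_forall fun x => ?_)
    simp only [Pi.sub_apply]
    ring
  have hsi1 : Integrable (fun x => (w (x - z) - w x) * φ x) := by
    refine (hs2.sub hwφ0).congr (Eventually.of_forall fun x => ?_)
    simp only [Pi.sub_apply]
    ring
  have hlhs : ∫ x, diffQuot w φ (x, x + z)
      = ∫ x, (z ^ 2)⁻¹ * ((w x - w (x + z)) * φ x - (w (x - z) - w x) * φ x) := by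
    rw [integral_const_mul, integral_sub hsi0 hsi1, ← hshift, ← integral_sub hsi0 hsi,
      ← integral_const_mul]
    refine integral_congr_ae (Eventually.of_forall fun x => ?_)
    simp only [diffQuot, sq_abs, sub_add_cancel_left, neg_sq]
    ring
  rw [hlhs]
  refine integral_mono hRz ((hsi0.sub hsi1).const_mul _) fun x => ?_
  have h1 := mul_le_mul_of_nonneg_right (barrier_second_difference hl0 x z) (hφ0 x)
  have h2 : w (-x + z) = w (x - z) := by
    rw [hw, ← barrier_neg]; congr 1; ring
  rw [h2, inv_mul_eq_div, le_div_iff₀ hz2]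
  simp only [← hw] at h1
  linarith

/-! ### Comparison with the barrier and decay at infinity -/

/-- Comparison of a weak solution with a multiple of the barrier. -/
lemma IsWeakSolution.barrier_comparison {Q g : ℝ → ℝ} (hu : IsWeakSolution a b Q g u)
    (hm : Measurable u) {l M k : ℝ} (hl : 1 ≤ l) (hM : 0 ≤ M) (hk : 0 ≤ k)
    (hz : ∀ᵐ x, x ∈ Ioo a b → u x ≤ M * barrier l x + k) :
    1 / (2 * Real.pi) * (∫ z in extSq a b, diffQuot (fun x => max (u x - M * barrier l x - k) 0)
        (fun x => max (u x - M * barrier l x - k) 0) z)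
      + (∫ x in extDom a b, u x * max (u x - M * barrier l x - k) 0)
      ≤ (∫ x in extDom a b, Q x * g (u x) * max (u x - M * barrier l x - k) 0)
        + 4 / l * ∫ x in extDom a b, M * barrier l x * max (u x - M * barrier l x - k) 0 := by
  have hl0 : 0 < l := by linarith
  have hw : MemH a b (barrier l) := memH_barrier hl
  have hψ := hw.const_mul M
  have hcomp := hu.comparison hψ hk
  have hφ := (hu.1.sub hψ).posPart_sub hk
  set φ : ℝ → ℝ := fun x => max (u x - M * barrier l x - k) 0 with hφdef
  have hφm : Measurable φ :=
    ((hm.sub ((continuous_barrier hl0).measurable.const_mul M)).sub_const k).max measurable_const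
  -- Because the test function vanishes on `(a, b)`, the integrals over `extSq` and `extDom` equal
  -- those over the whole plane and line, where the barrier inequality holds.
  have hφz : ∀ᵐ x, x ∈ Ioo a b → φ x = 0 := by
    filter_upwards [hz] with x hx hxm
    exact max_eq_right (by linarith [hx hxm])
  have hφz' : ∀ᵐ x, x ∉ extDom a b → φ x = 0 := by
    filter_upwards [hφz] with x hx hxm
    exact hx (by simpa [extDom] using hxm)
  have hφ2 : Integrable (fun x => φ x ^ 2) := by
    refine IntegrableOn.integrable_of_ae_notMem_eq_zero hφ.2.2 ?_
    filter_upwards [hφz'] with x hx hxm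
    simp [hx hxm]
  have hDz : ∀ᵐ z : ℝ × ℝ, z ∉ extSq a b → diffQuot (barrier l) φ z = 0 := by
    have h1 : ∀ᵐ z : ℝ × ℝ, z.1 ∈ Ioo a b → φ z.1 = 0 :=
      Measure.quasiMeasurePreserving_fst.ae hφz
    have h2 : ∀ᵐ z : ℝ × ℝ, z.2 ∈ Ioo a b → φ z.2 = 0 :=
      Measure.quasiMeasurePreserving_snd.ae hφz
    filter_upwards [h1, h2] with z h1 h2 hzn
    have hzm : z ∈ Ioo a b ×ˢ Ioo a b := by simpa only [extSq, mem_compl_iff, not_not] using hzn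
    simp [diffQuot, h1 hzm.1, h2 hzm.2]
  have hDi : Integrable (diffQuot (barrier l) φ) (volume : Measure (ℝ × ℝ)) :=
    IntegrableOn.integrable_of_ae_notMem_eq_zero (hw.integrableOn_diffQuot hφ) hDz
  have hb := le_integral_diffQuot_barrier hl hφm (fun x => le_max_right _ _) hφ2 hDi
  rw [← setIntegral_eq_integral_of_ae_compl_eq_zero hDz,
    ← setIntegral_eq_integral_of_ae_compl_eq_zero (s := extDom a b)
      (f := fun x => barrier l x * φ x)
      (by filter_upwards [hφz'] with x hx hxm; simp [hx hxm])] at hb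
  have e1 : ∫ z in extSq a b, diffQuot (fun x => M * barrier l x) φ z
      = M * ∫ z in extSq a b, diffQuot (barrier l) φ z := by
    simp only [diffQuot_const_mul_left]
    rw [integral_const_mul]
  have e2 : ∫ x in extDom a b, M * barrier l x * φ x
      = M * ∫ x in extDom a b, barrier l x * φ x := by
    rw [← integral_const_mul]; simp only [mul_assoc]
  rw [e1] at hcomp
  rw [e2]
  have h3 := mul_le_mul_of_nonneg_left hb (by positivity : 0 ≤ 1 / (2 * Real.pi) * M)
  have h4 : 1 / (2 * Real.pi) * M * (-(8 * Real.pi / l) * ∫ x in extDom a b, barrier l x * φ x)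
      = -(4 / l * (M * ∫ x in extDom a b, barrier l x * φ x)) := by
    field_simp
    ring
  rw [h4] at h3
  linarith

lemma setIntegral_le_const_mul_measure {D S : Set ℝ} (hD : MeasurableSet D) (hS : MeasurableSet S)
    (hSD : S ⊆ D) (hSf : volume S ≠ ⊤) {F : ℝ → ℝ} {c : ℝ} (hF0 : ∀ x ∈ D, 0 ≤ F x)
    (hFS : ∀ᵐ x, x ∈ S → F x ≤ c) (hFD : ∀ x ∈ D, x ∉ S → F x = 0) :
    ∫ x in D, F x ≤ c * volume.real S := by
  have e1 : c * volume.real S = ∫ x in D, S.indicator (fun _ => c) x := by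
    rw [setIntegral_indicator hS, inter_eq_right.2 hSD, setIntegral_const, smul_eq_mul, mul_comm]
  rw [e1]
  refine integral_mono_of_nonneg ?_ ?_ ?_
  · exact (ae_restrict_iff' hD).2 (Eventually.of_forall hF0)
  · rw [integrable_indicator_iff hS]
    exact (integrableOn_const hSf).mono_measure Measure.restrict_le_self
  · refine (ae_restrict_iff' hD).2 ?_
    filter_upwards [hFS] with x hx hxD
    by_cases hxS : x ∈ S
    · simpa [indicator_of_mem hxS] using hx hxS
    · simp [indicator_of_notMem hxS, hFD x hxD hxS]

lemma tendsto_integral_sq_tail (hu : MemH a b u) :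
    Tendsto (fun n : ℕ => ∫ x in extDom a b ∩ {x | (n : ℝ) < |x|}, u x ^ 2) atTop (𝓝 0) := by
  have h := Antitone.tendsto_setIntegral (μ := volume) (f := fun x => u x ^ 2)
    (s := fun n : ℕ => extDom a b ∩ {x | (n : ℝ) < |x|})
    (fun n => measurableSet_extDom.inter (measurableSet_lt measurable_const (by fun_prop)))
    (fun m n hmn x hx => ⟨hx.1, lt_of_le_of_lt (Nat.cast_le (α := ℝ).2 hmn) hx.2⟩)
    (hu.2.2.mono_set inter_subset_left)
  have he : ⋂ n : ℕ, extDom a b ∩ {x | (n : ℝ) < |x|} = ∅ := by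
    refine eq_empty_of_forall_notMem fun x hx => ?_
    obtain ⟨n, hn⟩ := exists_nat_ge |x|
    exact absurd (mem_iInter.1 hx n).2 (not_lt.2 hn)
  rw [he] at h
  simpa using h

/-- Bounded weak solutions vanish at infinity. -/
lemma IsWeakSolution.exists_ae_le_of_lt_abs {Q g : ℝ → ℝ} (hu : IsWeakSolution a b Q g u)
    (hm : Measurable u) {Qm G K : ℝ} (hQ0 : ∀ x ∈ extDom a b, 0 ≤ Q x)
    (hQm : ∀ x ∈ extDom a b, Q x ≤ Qm) (hg0 : ∀ s, 0 ≤ g s) (hK : 0 < K)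
    (hg : ∀ s ≤ K, g s ≤ G) (huK : ∀ᵐ x, u x ≤ K) {δ : ℝ} (hδ : 0 < δ) :
    ∃ R : ℝ, ∀ᵐ x, R < |x| → u x ≤ δ := by
  have hG : 0 ≤ G := (hg0 0).trans (hg 0 hK.le)
  have hQm0 : 0 ≤ Qm := by
    have : a ∈ extDom a b := fun h => lt_irrefl _ h.1
    exact (hQ0 a this).trans (hQm a this)
  -- Bound for the right side per unit measure: `Qm * G` for the nonlinearity, `4 / R ≤ 4` times `M
  -- w ≤ 2K` for the barrier, and `K` for the test function.
  set C := (Qm * G + 4 * (2 * K)) * K with hC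
  have hC0 : 0 ≤ C := by positivity
  set B := (8 * Real.pi * C) ^ 2 with hB
  have hlim : Tendsto (fun n : ℕ => (∫ x in extDom a b ∩ {x | (n : ℝ) < |x|}, u x ^ 2)
      / (δ / 4) ^ 2) atTop (𝓝 0) := by
    simpa using (tendsto_integral_sq_tail hu.1).div_const ((δ / 4) ^ 2)
  have hlimB := hlim.const_mul B
  rw [mul_zero] at hlimB
  -- By Chebyshev the tail integral bounds the measure at level `δ / 4`. It is made small enough to
  -- start the iteration, and below `1` so that the fourth power of `μ k` obtained later is at most
  -- its cube.
  obtain ⟨n, ⟨⟨hn1, hn2⟩, hn3⟩, hn4⟩ := (((hlim.eventually (gt_mem_nhds one_pos)).and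
    (hlimB.eventually (gt_mem_nhds (show (0 : ℝ) < ((δ / 4) ^ 2 / 64) ^ 2 by positivity)))).and
    (eventually_ge_atTop ⌈max |a| |b|⌉₊)).and (eventually_ge_atTop 1) |>.exists
  have hR1 : (1 : ℝ) ≤ n := by exact_mod_cast hn4
  have hRab : max |a| |b| ≤ n := (Nat.le_ceil _).trans (by exact_mod_cast hn3)
  set R : ℝ := (n : ℝ) with hR
  have hR0 : 0 < R := by linarith
  -- Then `M w` is at least `K` on `[-R, R]`, which contains `(a, b)`, and at most `2K` everywhere.
  set M := 2 * K * R ^ 2 with hM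
  have hM0 : 0 ≤ M := by positivity
  have hbar_lo : ∀ x, |x| ≤ R → K ≤ M * barrier R x := fun x hx => by
    have hx2 : x ^ 2 ≤ R ^ 2 := sq_le_sq.2 (by rwa [abs_of_pos hR0])
    rw [barrier, ← div_eq_mul_inv, le_div_iff₀ (by positivity)]
    nlinarith
  have hbar_hi : ∀ x, M * barrier R x ≤ 2 * K := fun x => by
    rw [barrier, ← div_eq_mul_inv, div_le_iff₀ (by positivity)]
    nlinarith [mul_nonneg hK.le (sq_nonneg x)]
  have hbar0 : ∀ x, 0 ≤ M * barrier R x := fun x => mul_nonneg hM0 (barrier_nonneg _ _)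
  set v : ℝ → ℝ := fun x => u x - M * barrier R x with hv
  have hvH : MemH a b v := hu.1.sub ((memH_barrier hR1).const_mul M)
  have hvm : Measurable v := hm.sub ((continuous_barrier hR0).measurable.const_mul M)
  set μ : ℝ → ℝ := fun k => volume.real (superlevel a b v k) with hμ
  have hk0 : 0 < δ / 4 := by positivity
  have hin : ∀ᵐ x, |x| ≤ R → u x ≤ M * barrier R x := by
    filter_upwards [huK] with x hx hxR
    exact hx.trans (hbar_lo x hxR)
  have hμ0 : μ (δ / 4) ≤ (∫ x in extDom a b ∩ {x | (n : ℝ) < |x|}, u x ^ 2) / (δ / 4) ^ 2 := by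
    have hSm : MeasurableSet (superlevel a b v (δ / 4) ∩ {x | (n : ℝ) < |x|}) :=
      (measurableSet_superlevel hvm _).inter (measurableSet_lt measurable_const (by fun_prop))
    have hae : volume (superlevel a b v (δ / 4))
        = volume (superlevel a b v (δ / 4) ∩ {x | (n : ℝ) < |x|}) := by
      refine measure_congr ?_
      filter_upwards [hin] with x hx
      refine propext ⟨fun h => ⟨h, ?_⟩, fun h => h.1⟩
      by_contra hcon
      have h1 := hx (not_lt.1 hcon)
      have h2 : δ / 4 < u x - M * barrier R x := h.2
      linarith
    refine ENNReal.toReal_le_of_le_ofReal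
      (div_nonneg (integral_nonneg fun x => sq_nonneg _) (by positivity)) ?_
    rw [hae]
    refine (measure_le_integral_sq_div hu.1 hSm (fun x hx => hx.1.1) hk0 fun x hx => ?_).trans
      (ENNReal.ofReal_le_ofReal ?_)
    · have h2 : δ / 4 < u x - M * barrier R x := hx.1.2
      linarith [hbar0 x]
    · refine div_le_div_of_nonneg_right (setIntegral_mono_set (hu.1.2.2.mono_set inter_subset_left)
        (Eventually.of_forall fun x => sq_nonneg _)
        (Eventually.of_forall fun x hx => ⟨hx.1.1, hx.2⟩)) (by positivity)
  have hanti : ∀ k l, δ / 4 ≤ k → k ≤ l → μ l ≤ μ k := fun k l hk hkl =>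
    measureReal_mono (superlevel_anti hkl) (measure_superlevel_ne_top hvH hvm (hk0.trans_le hk))
  have hmain : ∀ k l, δ / 4 ≤ k → k < l → ((l - k) ^ 2 * μ l) ^ 2 ≤ B * μ k ^ 3 := by
    intro k l hk hkl
    have hkp : 0 < k := hk0.trans_le hk
    have hSf := measure_superlevel_ne_top hvH hvm hkp
    have hS := measurableSet_superlevel (a := a) (b := b) hvm k
    have hcmp := hu.barrier_comparison hm hR1 hM0 hkp.le (by
      filter_upwards [hin] with x hx hxm
      have : |x| ≤ R := by
        refine le_trans (abs_le.2 ⟨?_, ?_⟩) hRab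
        · linarith [hxm.1, neg_abs_le a, le_max_left |a| |b|]
        · linarith [hxm.2, le_abs_self b, le_max_right |a| |b|]
      linarith [hx this])
    have hen := superlevel_energy_le hvH hvm hkp hkl.le
    set φ : ℝ → ℝ := fun x => max (u x - M * barrier R x - k) 0 with hφ
    have hφ0 : ∀ x, 0 ≤ φ x := fun x => le_max_right _ _
    have hφz : ∀ x ∈ extDom a b, x ∉ superlevel a b v k → φ x = 0 := fun x hx hxn => by
      have : ¬ k < u x - M * barrier R x := fun h => hxn ⟨hx, h⟩
      exact max_eq_right (by linarith)
    have hφK : ∀ x, u x ≤ K → φ x ≤ K := fun x hx =>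
      max_le (by linarith [hbar0 x]) hK.le
    have hp : 0 ≤ ∫ x in extDom a b, u x * φ x := by
      refine integral_nonneg fun x => ?_
      rcases le_total (u x - M * barrier R x - k) 0 with h | h
      · simp [hφ, max_eq_right h]
      · exact mul_nonneg (by linarith [hbar0 x]) (hφ0 x)
    have hI1 : ∫ x in extDom a b, Q x * g (u x) * φ x ≤ Qm * G * K * μ k := by
      refine setIntegral_le_const_mul_measure measurableSet_extDom hS inter_subset_left hSf
        (fun x hx => mul_nonneg (mul_nonneg (hQ0 x hx) (hg0 _)) (hφ0 x)) ?_
        (fun x hx hxn => by rw [hφz x hx hxn, mul_zero])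
      filter_upwards [huK] with x hx hxS
      have h1 := hQm x hxS.1
      have h2 := hg (u x) hx
      have h3 := hφK x hx
      have h4 := hg0 (u x)
      have h5 := hφ0 x
      gcongr
    have hI2 : ∫ x in extDom a b, M * barrier R x * φ x ≤ 2 * K * K * μ k := by
      refine setIntegral_le_const_mul_measure measurableSet_extDom hS inter_subset_left hSf
        (fun x hx => mul_nonneg (hbar0 x) (hφ0 x)) ?_
        (fun x hx hxn => by rw [hφz x hx hxn, mul_zero])
      filter_upwards [huK] with x hx hxS
      have h1 := hbar_hi x
      have h3 := hφK x hx
      have h5 := hφ0 x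
      gcongr
    set E := ∫ z in extSq a b, diffQuot φ φ z
    have hμk : 0 ≤ μ k := measureReal_nonneg
    have h4R : 4 / R ≤ 4 := div_le_self (by norm_num) hR1
    have hJ0 : 0 ≤ ∫ x in extDom a b, M * barrier R x * φ x :=
      integral_nonneg fun x => mul_nonneg (hbar0 x) (hφ0 x)
    have hE : E ≤ 2 * Real.pi * (C * μ k) := by
      have h1 : 1 / (2 * Real.pi) * E ≤ C * μ k := by
        have := (mul_le_mul_of_nonneg_right h4R hJ0).trans
          (mul_le_mul_of_nonneg_left hI2 (by norm_num : (0 : ℝ) ≤ 4))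
        rw [hC]
        linarith
      rwa [one_div, inv_mul_le_iff₀ (by positivity)] at h1
    have hμ1 : μ k ≤ 1 := (hanti _ _ le_rfl hk).trans (hμ0.trans hn1.le)
    have hμl : 0 ≤ μ l := measureReal_nonneg
    have h6 : (l - k) ^ 2 * μ l ≤ 8 * Real.pi * C * μ k ^ 2 := by
      calc _ ≤ 4 * μ k * E := hen
        _ ≤ 4 * μ k * (2 * Real.pi * (C * μ k)) := by gcongr
        _ = _ := by ring
    calc ((l - k) ^ 2 * μ l) ^ 2 ≤ (8 * Real.pi * C * μ k ^ 2) ^ 2 := by gcongr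
      _ = B * μ k ^ 3 * μ k := by rw [hB]; ring
      _ ≤ B * μ k ^ 3 := mul_le_of_le_one_right (by positivity) hμ1
  have hz : μ (δ / 4 + δ / 4) = 0 := eq_zero_of_stampacchia hk0 (fun k _ => measureReal_nonneg)
    hanti hmain ((mul_le_mul_of_nonneg_left hμ0 (by positivity)).trans hn2.le)
  have hnull : volume (superlevel a b v (δ / 4 + δ / 4)) = 0 :=
    ((ENNReal.toReal_eq_zero_iff _).1 hz).resolve_right
      (measure_superlevel_ne_top hvH hvm (by positivity))
  -- The iteration gives `u ≤ M w + δ / 2` on `extDom`; beyond this radius `M w ≤ M / x²` is at most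
  -- the other `δ / 2`.
  refine ⟨max R (2 * M / δ + 1), ?_⟩
  filter_upwards [measure_eq_zero_iff_ae_notMem.1 hnull] with x hx hxR
  have hxR1 : R < |x| := (le_max_left _ _).trans_lt hxR
  have hxR2 : 2 * M / δ + 1 < |x| := (le_max_right _ _).trans_lt hxR
  have hxe : x ∈ extDom a b := fun hxm => by
    refine absurd hxR1 (not_lt.2 (le_trans (abs_le.2 ⟨?_, ?_⟩) hRab))
    · linarith [hxm.1, neg_abs_le a, le_max_left |a| |b|]
    · linarith [hxm.2, le_abs_self b, le_max_right |a| |b|]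
  have h1 : ¬ δ / 4 + δ / 4 < u x - M * barrier R x := fun h => hx ⟨hxe, h⟩
  have h2 : M * barrier R x ≤ δ / 2 := by
    rw [barrier, ← div_eq_mul_inv, div_le_iff₀ (by positivity)]
    have h3 : 2 * M / δ < |x| ^ 2 := by nlinarith [abs_nonneg x, div_nonneg (by positivity : 0 ≤ 2 * M) hδ.le]
    rw [div_lt_iff₀ hδ, sq_abs] at h3
    nlinarith [mul_pos hδ (pow_pos hR0 2)]
  linarith

/-- Weak solutions decay quadratically. -/
lemma IsWeakSolution.exists_ae_le_div_sq {Q g : ℝ → ℝ} (hu : IsWeakSolution a b Q g u)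
    (hm : Measurable u) {Qm C δ : ℝ} (hQ0 : ∀ x ∈ extDom a b, 0 ≤ Q x)
    (hQm : ∀ x ∈ extDom a b, Q x ≤ Qm) (hg0 : ∀ s, 0 ≤ g s) (hgz : ∀ s ≤ 0, g s = 0)
    (hg : ∀ s, g s ≤ C * Real.exp (Real.pi * s ^ 2)) (hδ : 0 < δ)
    (hgδ : ∀ s, 0 < s → s ≤ δ → Qm * g s ≤ s / 4) :
    ∃ M : ℝ, 0 < M ∧ ∀ᵐ x, x ≠ 0 → u x ≤ M / |x| ^ 2 := by
  obtain ⟨K, hK, huK⟩ := hu.exists_ae_le hm hQ0 hQm hg0 hg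
  have hC : 0 ≤ C := by simpa using (hg0 0).trans (hg 0)
  have hgK : ∀ s ≤ K, g s ≤ C * Real.exp (Real.pi * K ^ 2) := fun s hs => by
    rcases le_total s 0 with h | h
    · rw [hgz s h]; positivity
    · exact (hg s).trans (by gcongr)
  obtain ⟨R₁, hR₁⟩ := hu.exists_ae_le_of_lt_abs hm hQ0 hQm hg0 hK hgK huK hδ
  set R := max R₁ (max |a| |b|) with hR
  have hR0 : 0 ≤ R := (abs_nonneg a).trans ((le_max_left _ _).trans (le_max_right _ _))
  set M := K * (16 ^ 2 + R ^ 2) with hM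
  have hM0 : 0 < M := by positivity
  have hlo : ∀ x, |x| ≤ R → K ≤ M * barrier 16 x := fun x hx => by
    have hx2 : x ^ 2 ≤ R ^ 2 := sq_le_sq.2 (by rwa [abs_of_nonneg hR0])
    rw [barrier, ← div_eq_mul_inv, le_div_iff₀ (by positivity)]
    nlinarith
  have hb0 : ∀ x, 0 ≤ M * barrier 16 x := fun x => mul_nonneg hM0.le (barrier_nonneg _ _)
  have hin : ∀ x ∈ Ioo a b, |x| ≤ R := fun x hxm => by
    refine le_trans (abs_le.2 ⟨?_, ?_⟩) (le_max_right R₁ (max |a| |b|))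
    · linarith [hxm.1, neg_abs_le a, le_max_left |a| |b|]
    · linarith [hxm.2, le_abs_self b, le_max_right |a| |b|]
  -- With `l = 16` the barrier term is at most `1/4` of `∫ u φ`, and so is the nonlinear term, since
  -- `φ` is supported where `u ≤ δ`. Half of `∫ u φ` then remains on the left, which forces it to
  -- vanish.
  have hcmp := hu.barrier_comparison hm (l := 16) (by norm_num) hM0.le le_rfl (by
    filter_upwards [huK] with x hx hxm
    linarith [hlo x (hin x hxm)])
  have hψ : MemH a b (fun x => M * barrier 16 x) := (memH_barrier (by norm_num)).const_mul M
  have hφH := (hu.1.sub hψ).posPart_sub le_rfl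
  set φ : ℝ → ℝ := fun x => max (u x - M * barrier 16 x - 0) 0 with hφ
  have hφ0 : ∀ x, 0 ≤ φ x := fun x => le_max_right _ _
  have huφ : ∀ x, M * barrier 16 x * φ x ≤ u x * φ x := fun x => by
    rcases le_total (u x - M * barrier 16 x - 0) 0 with h | h
    · rw [show φ x = 0 from max_eq_right h, mul_zero, mul_zero]
    · exact mul_le_mul_of_nonneg_right (by linarith) (hφ0 x)
  have hint : IntegrableOn (fun x => u x * φ x) (extDom a b) := hu.1.integrableOn_mul hφH
  have hI2 : ∫ x in extDom a b, M * barrier 16 x * φ x ≤ ∫ x in extDom a b, u x * φ x :=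
    integral_mono (hψ.integrableOn_mul hφH) hint huφ
  have hI1 : ∫ x in extDom a b, Q x * g (u x) * φ x
      ≤ ∫ x in extDom a b, 1 / 4 * (u x * φ x) := by
    refine integral_mono_of_nonneg ?_ (hint.const_mul _) ?_
    · exact (ae_restrict_iff' measurableSet_extDom).2 (Eventually.of_forall fun x hx =>
        mul_nonneg (mul_nonneg (hQ0 x hx) (hg0 _)) (hφ0 x))
    · refine (ae_restrict_iff' measurableSet_extDom).2 ?_
      filter_upwards [huK, hR₁] with x hxK hxR hxe
      rcases le_or_gt (u x - M * barrier 16 x - 0) 0 with h | h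
      · simp [show φ x = 0 from max_eq_right h]
      have hxR' : R < |x| := by
        by_contra hcon
        linarith [hlo x (not_lt.1 hcon)]
      have hux : 0 < u x := by linarith [hb0 x]
      have h1 := hgδ (u x) hux (hxR ((le_max_left _ _).trans_lt hxR'))
      have h2 : Q x * g (u x) ≤ u x / 4 :=
        (mul_le_mul_of_nonneg_right (hQm x hxe) (hg0 _)).trans h1
      have := mul_le_mul_of_nonneg_right h2 (hφ0 x)
      linarith
  rw [integral_const_mul] at hI1
  have hE0 : 0 ≤ 1 / (2 * Real.pi) * ∫ z in extSq a b, diffQuot φ φ z :=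
    mul_nonneg (by positivity) (integral_nonneg fun z => diffQuot_self_nonneg φ z)
  have hnn : ∀ x, 0 ≤ u x * φ x := fun x => (mul_nonneg (hb0 x) (hφ0 x)).trans (huφ x)
  have hzero : ∫ x in extDom a b, u x * φ x = 0 := by
    refine le_antisymm ?_ (integral_nonneg hnn)
    linarith
  rw [integral_eq_zero_iff_of_nonneg hnn hint] at hzero
  refine ⟨M, hM0, ?_⟩
  filter_upwards [(ae_restrict_iff' measurableSet_extDom).1 hzero, huK] with x hx hxK hx0
  have hle : u x ≤ M * barrier 16 x := by
    by_cases hxe : x ∈ extDom a b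
    · by_contra hcon
      have h1 : 0 < u x - M * barrier 16 x - 0 := by linarith
      have h2 : 0 < u x * φ x := mul_pos (by linarith [hb0 x]) (lt_max_of_lt_left h1)
      have h3 : u x * φ x = 0 := hx hxe
      linarith
    · exact hxK.trans (hlo x (hin x (by simpa [extDom] using hxe)))
  refine hle.trans ?_
  rw [barrier, ← div_eq_mul_inv, sq_abs]
  gcongr
  linarith

/-! ### Representatives, bounds on the data and conclusion -/

/-- Allows passing to a Borel representative, for which the superlevel sets are measurable. -/
lemma IsWeakSolution.congr_ae {Q g : ℝ → ℝ} (hu : IsWeakSolution a b Q g u) (huv : u =ᵐ[volume] v) :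
    IsWeakSolution a b Q g v := by
  have hd : ∀ {w w' : ℝ → ℝ}, w =ᵐ[volume] w' →
      diffQuot u w =ᵐ[(volume : Measure (ℝ × ℝ))] diffQuot v w' := fun {w w'} hw => by
    have h1 : ∀ᵐ z : ℝ × ℝ, u z.1 = v z.1 := Measure.quasiMeasurePreserving_fst.ae huv
    have h2 : ∀ᵐ z : ℝ × ℝ, u z.2 = v z.2 := Measure.quasiMeasurePreserving_snd.ae huv
    have h3 : ∀ᵐ z : ℝ × ℝ, w z.1 = w' z.1 := Measure.quasiMeasurePreserving_fst.ae hw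
    have h4 : ∀ᵐ z : ℝ × ℝ, w z.2 = w' z.2 := Measure.quasiMeasurePreserving_snd.ae hw
    filter_upwards [h1, h2, h3, h4] with z h1 h2 h3 h4
    simp [diffQuot, h1, h2, h3, h4]
  refine ⟨⟨hu.1.1.congr huv, hu.1.2.1.congr (ae_restrict_of_ae (hd huv)),
    hu.1.2.2.congr (ae_restrict_of_ae (by filter_upwards [huv] with x hx; rw [hx]))⟩,
    fun w hw => ?_⟩
  rw [← integral_congr_ae (ae_restrict_of_ae (hd (ae_eq_refl w))),
    integral_congr_ae (f := fun x => v x * w x) (g := fun x => u x * w x)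
      (ae_restrict_of_ae (by filter_upwards [huv] with x hx; rw [hx])), hu.2 w hw]
  exact integral_congr_ae (ae_restrict_of_ae (by filter_upwards [huv] with x hx; rw [hx]))

lemma exists_upper_bound_of_tendsto {Q : ℝ → ℝ} {Qt : ℝ} (hQ : ContinuousOn Q (extDom a b))
    (hQlim : Tendsto Q (cocompact ℝ) (𝓝 Qt)) : ∃ Qm : ℝ, ∀ x ∈ extDom a b, Q x ≤ Qm := by
  obtain ⟨t, ht, hts⟩ := mem_cocompact.1 (hQlim.eventually (gt_mem_nhds (lt_add_one Qt)))
  have hclosed : IsClosed (extDom a b) := isOpen_Ioo.isClosed_compl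
  obtain ⟨m, hm⟩ := (ht.inter_right hclosed).bddAbove_image (hQ.mono inter_subset_right)
  refine ⟨max m (Qt + 1), fun x hx => ?_⟩
  by_cases hxt : x ∈ t
  · exact le_max_of_le_left (hm ⟨x, ⟨hxt, hx⟩, rfl⟩)
  · exact le_max_of_le_right (le_of_lt (hts hxt))

/-- As `q > 1`, the ratio `f s / s` is of order `s ^ (q - 1)` and tends to `0` as `s` decreases to
`0`. -/
lemma exists_mul_le_of_isBigO {f : ℝ → ℝ} {q : ℝ} (hq : 1 < q)
    (hf : f =O[𝓝[≠] 0] fun s => |s| ^ q) (m : ℝ) {ε : ℝ} (hε : 0 < ε) :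
    ∃ δ : ℝ, 0 < δ ∧ ∀ s, 0 < s → s ≤ δ → m * f s ≤ ε * s := by
  obtain ⟨c, hc⟩ := hf.bound
  have hcont : Tendsto (fun s : ℝ => |m| * c * s ^ (q - 1)) (𝓝 0) (𝓝 (|m| * c * 0)) := by
    have h := (Real.continuousAt_rpow_const 0 (q - 1) (Or.inr (by linarith))).tendsto
    rw [Real.zero_rpow (by linarith)] at h
    exact h.const_mul _
  rw [mul_zero] at hcont
  have h2 : ∀ᶠ s in 𝓝[>] (0 : ℝ), |m| * c * s ^ (q - 1) < ε :=
    (hcont.eventually (gt_mem_nhds hε)).filter_mono nhdsWithin_le_nhds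
  have h1 : ∀ᶠ s in 𝓝[>] (0 : ℝ), ‖f s‖ ≤ c * ‖|s| ^ q‖ :=
    hc.filter_mono (nhdsWithin_mono _ fun s (hs : 0 < s) => hs.ne')
  obtain ⟨δ, hδ, hδs⟩ := mem_nhdsGT_iff_exists_Ioc_subset.1 (h1.and h2)
  refine ⟨δ, hδ, fun s hs hsδ => ?_⟩
  obtain ⟨h3, h4⟩ := hδs ⟨hs, hsδ⟩
  rw [Real.norm_eq_abs, Real.norm_eq_abs, abs_of_pos hs,
    abs_of_nonneg (Real.rpow_nonneg hs.le q)] at h3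
  calc m * f s ≤ |m * f s| := le_abs_self _
    _ = |m| * |f s| := abs_mul _ _
    _ ≤ |m| * (c * s ^ q) := by gcongr
    _ = |m| * c * s ^ (q - 1) * s := by
        rw [Real.rpow_sub_one hs.ne']; field_simp
    _ ≤ ε * s := by gcongr

end ExteriorNeumann

theorem lemma5p4 (a b : ℝ) (hab : a < b)
    -- the weight `Q` and its limit
    (Q : ℝ → ℝ) (Qt : ℝ) (hQ : ContinuousOn Q (Ioo a b)ᶜ) (hQt : 0 < Qt)
    (hQge : ∀ x ∈ (Ioo a b)ᶜ, Qt ≤ Q x) (hQlim : Tendsto Q (cocompact ℝ) (𝓝 Qt))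
    -- the nonlinearity
    (f : ℝ → ℝ) (hf : ContDiff ℝ 1 f) (hodd : ∀ s, f (-s) = -f s)
    (hf1 : ∃ C : ℝ, ∀ s, |f s| ≤ C * Real.exp (Real.pi * |s| ^ 2))
    (θ : ℝ) (hθ : 2 < θ)
    (hf2 : ∀ s, s ≠ 0 → 0 < θ * ExteriorNeumann.primitive f s ∧
      θ * ExteriorNeumann.primitive f s ≤ s * f s)
    (q : ℝ) (hq : 1 < q) (hf3 : f =O[𝓝[≠] 0] fun s => |s| ^ q)
    (hf4 : MonotoneOn (fun s => f s / s) (Ioi 0))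
    (ξ : ℝ) (hξ : 0 < ξ) (hξE : ExteriorNeumann.IsExtensionBound a b ξ)
    (p Cp : ℝ) (hp : q + 1 < p) (hCp : 0 < Cp)
    (hf5 : ∀ s : ℝ, 0 ≤ s → Cp * s ^ (p - 1) ≤ f s)
    (hCp5 : ((p - 2) * (2 * ξ * θ) / ((θ - 2) * p)) ^ ((p - 2) / 2)
      * ExteriorNeumann.sobolevConst Qt p ^ p < Cp)
    -- the ground state, for the nonlinearity set to zero on the nonpositive half-line
    (u : ℝ → ℝ)
    (hu : ExteriorNeumann.IsGroundState a b Q (ExteriorNeumann.truncation f) u) :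
    ∃ C : ℝ, 0 < C ∧ ∀ᵐ x : ℝ, x ≠ 0 → 0 ≤ u x ∧ u x ≤ C / |x| ^ 2 := by
  obtain ⟨C, hC⟩ := hf1
  have hC0 : 0 ≤ C := by simpa using (abs_nonneg _).trans (hC 0)
  have hfpos : ∀ s, 0 < s → 0 < f s := fun s hs => by
    obtain ⟨h1, h2⟩ := hf2 s hs.ne'
    exact pos_of_mul_pos_right (h1.trans_le h2) hs.le
  have hg0 : ∀ s, 0 ≤ ExteriorNeumann.truncation f s := fun s => by
    unfold ExteriorNeumann.truncation
    split_ifs with h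
    · exact le_rfl
    · exact (hfpos s (not_le.1 h)).le
  have hgz : ∀ s ≤ 0, ExteriorNeumann.truncation f s = 0 := fun s hs => if_pos hs
  have hg : ∀ s, ExteriorNeumann.truncation f s ≤ C * Real.exp (Real.pi * s ^ 2) := fun s => by
    unfold ExteriorNeumann.truncation
    split_ifs with h
    · positivity
    · simpa only [sq_abs] using (le_abs_self _).trans (hC s)
  obtain ⟨Qm, hQm⟩ := ExteriorNeumann.exists_upper_bound_of_tendsto hQ hQlim
  obtain ⟨δ, hδ, hfδ⟩ := ExteriorNeumann.exists_mul_le_of_isBigO hq hf3 Qm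
    (show (0 : ℝ) < 1 / 4 by norm_num)
  have hum : AEMeasurable u volume := hu.1.1.1
  have hv := hu.1.congr_ae hum.ae_eq_mk
  obtain ⟨M, hM, hle⟩ := hv.exists_ae_le_div_sq hum.measurable_mk
    (fun x hx => hQt.le.trans (hQge x hx)) hQm hg0 hgz hg hδ (fun s hs hsδ => by
      have h := hfδ s hs hsδ
      rw [ExteriorNeumann.truncation, if_neg (not_le.2 hs)]
      linarith)
  refine ⟨M, hM, ?_⟩
  filter_upwards [hu.1.ae_nonneg hgz, hle, hum.ae_eq_mk] with x h0 h1 h2 hx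
  exact ⟨h0, h2 ▸ h1 hx⟩
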